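/- Let $N=(A,\mathfrak C)$ be a regular oriented matroid on a finite ground set $A$, i.e. an oriented matroid, with set of signed circuits $\mathfrak C$, represented over $\mathbb R$ by a totally unimodular matrix. Let $\underline N$ be its underlying matroid, and for $C=(C^+,C^-)\in\mathfrak C$ and $x\in\mathbb R^A$ put $\langle \overline C,x\rangle=\sum_{a\in C^+}x_a-\sum_{a\in C^-}x_a$. Let $\Pi_N$ be the set of points $x\in[0,1/2]^A$ such that $\langle\overline C,x\rangle\in\mathbb Z$ for all $C\in\mathfrak C$, and let $\Pi_N^>=\Pi_N\cap(0,1/2)^A$. For $x\in\Pi_N$ let $\alpha_x:\mathfrak C\to\mathbb Z$, $\alpha_x(C)=\langle\overline C,x\rangle$. Let $\Omega_N^{\ge}=\{\alpha_x\mid x\in\Pi_N\}$, $\Omega_N^{>}=\{\alpha_x\mid x\in\Pi_N^>\}$, and for $\alpha\in\Omega_N^{\ge}$ let $\Pi_{N,\alpha}$ be the polytope $\{x\in\Pi_N\mid\alpha_x=\alpha\}$. For $S\subseteq A$ let ${}_{-S}N$ be the oriented matroid obtained from $N$ by reorienting the elements of $S$. Reorientations are considered as labelled objects: ${}_{-S}N$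 is recorded together with the set $S$, so that different sets give different reorientations. A cocycle of $\underline N$ is a disjoint union of cocircuits of $\underline N$, and a positive cocycle of an oriented matroid is a disjoint union of supports of positive signed cocircuits (the empty set is a positive cocycle). The class $[{}_{-S}N]$ of ${}_{-S}N$ in the cocycle reversing system is the set of reorientations ${}_{-T}N$, $T\subseteq A$, obtained from ${}_{-S}N$ by reorienting a positive cocycle of ${}_{-S}N$, i.e. such that $S\triangle T$ is a positive cocycle of ${}_{-S}N$. An oriented matroid is acyclic if each of its elements belongs to a positive cocircuit, and a class is acyclic if all the reorientations in it are acyclic. For every $\alpha\in\Omega_N^{\ge}$ the polytope $\Pi_{N,\alpha}$ has at least one vertex, and all its vertices have coordinates in $\{0,1/2\}$; for such a vertex $x$ put $S(x)=\{a\in A\mid x_a=1/2\}$. Then there is a well-defined map $$\Psi:\Omega_N^{\ge}\to\{[{}_{-S}N]\mid S\subseteq A \text{ cocycle of }\underline N\},\qquad \Psi(\alpha)=[{}_{-S(x)}N]\ \text{ for every vertex } x \text{ of } \Pi_{N,\alpha},$$ and $\Psi$ is a bijection. Moreover $\alpha\in\Omega_N^{\ge}$ belongs to $\Omega_N^{>}$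 if and only if the class $\Psi(\alpha)$ is acyclic. Consequently $\Omega_N^{\ge}$ and $\Omega_N^{>}$ are finite, $$|\Omega_N^{\ge}|=\#\{[{}_{-S}N]\mid S\subseteq A\text{ cocycle of }\underline N\},\qquad |\Omega_N^{>}|=\#\{[{}_{-S}N]\mid S\subseteq A\text{ cocycle of }\underline N\text{ such that }{}_{-S}N\text{ is acyclic}\}.$$ -/

import Mathlib

/-- A signed set from `A`: an ordered pair of disjoint subsets of `A`. -/
@[ext]
structure SignedSet (A : Type*) where
  pos : Set A
  neg : Set A
  disj : Disjoint pos neg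

namespace SignedSet

variable {A : Type*}

/-- The support `X⁺ ∪ X⁻`. -/
def support (X : SignedSet A) : Set A := X.pos ∪ X.neg

/-- The opposite signed set `-X = (X⁻, X⁺)`. -/
def opp (X : SignedSet A) : SignedSet A := ⟨X.neg, X.pos, X.disj.symm⟩

/-- The empty signed set `(∅, ∅)`. -/
def empty (A : Type*) : SignedSet A := ⟨∅, ∅, Set.disjoint_empty ∅⟩

/-- The incidence vector of a signed set: `1` on `X⁺`, `-1` on `X⁻`, and `0` elsewhere. -/
noncomputable def vec (X : SignedSet A) : A → ℝ :=
  fun a => X.pos.indicator 1 a - X.neg.indicator 1 a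

/-- The signed set obtained from `X` by reversing the sign of the elements of `S`. -/
def reorient (X : SignedSet A) (S : Set A) : SignedSet A where
  pos := (X.pos \ S) ∪ (X.neg ∩ S)
  neg := (X.neg \ S) ∪ (X.pos ∩ S)
  disj := by
    have h := Set.disjoint_left.1 X.disj
    refine Set.disjoint_left.2 fun a ha hb => ?_
    rcases ha with ⟨h1, h2⟩ | ⟨h1, h2⟩ <;> rcases hb with ⟨h3, h4⟩ | ⟨h3, h4⟩
    · exact h h1 h3
    · exact h2 h4
    · exact h4 h2
    · exact h h3 h1

/-- Orthogonality of signed sets (in the sense of oriented matroids): the set of elements on which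
`X` and `Y` have the same sign and the set of elements on which they have opposite signs
are both empty or both non-empty. -/
def Orthogonal (X Y : SignedSet A) : Prop :=
  ((X.pos ∩ Y.pos) ∪ (X.neg ∩ Y.neg)).Nonempty ↔
    ((X.pos ∩ Y.neg) ∪ (X.neg ∩ Y.pos)).Nonempty

theorem support_opp (X : SignedSet A) : X.opp.support = X.support := Set.union_comm _ _

theorem support_reorient (X : SignedSet A) (S : Set A) :
    (X.reorient S).support = X.support := by
  ext a
  simp only [support, reorient, Set.mem_union, Set.mem_sdiff, Set.mem_inter_iff]
  tauto

theorem opp_reorient (X : SignedSet A) (S : Set A) : (X.reorient S).opp = X.opp.reorient S := rfl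

end SignedSet

/-- An oriented matroid on the ground set `A`, given by its signed circuits. -/
structure OrientedMatroid (A : Type*) where
  circuits : Set (SignedSet A)
  empty_notMem : SignedSet.empty A ∉ circuits
  opp_mem : ∀ X ∈ circuits, X.opp ∈ circuits
  incomparable : ∀ X ∈ circuits, ∀ Y ∈ circuits, X.support ⊆ Y.support → X = Y ∨ X = Y.opp
  elimination : ∀ X ∈ circuits, ∀ Y ∈ circuits, X ≠ Y.opp → ∀ a ∈ X.pos ∩ Y.neg,
    ∃ Z ∈ circuits, Z.pos ⊆ (X.pos ∪ Y.pos) \ {a} ∧ Z.neg ⊆ (X.neg ∪ Y.neg) \ {a}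

namespace OrientedMatroid

variable {A : Type*}

/-- A set is independent if it contains the support of no circuit. -/
def Indep (N : OrientedMatroid A) (I : Set A) : Prop := ∀ X ∈ N.circuits, ¬ X.support ⊆ I

theorem weak_elimination (N : OrientedMatroid A) {X Y : SignedSet A} (hX : X ∈ N.circuits)
    (hY : Y ∈ N.circuits) (hXY : X.support ≠ Y.support) {a : A} (haX : a ∈ X.support)
    (haY : a ∈ Y.support) :
    ∃ Z ∈ N.circuits, Z.support ⊆ (X.support ∪ Y.support) \ {a} := by
  have key : ∀ U ∈ N.circuits, ∀ V ∈ N.circuits, U.support ≠ V.support → a ∈ U.pos →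
      a ∈ V.neg → ∃ Z ∈ N.circuits, Z.support ⊆ (U.support ∪ V.support) \ {a} := by
    intro U hU V hV hUV h1 h2
    obtain ⟨Z, hZ, hp, hn⟩ := N.elimination U hU V hV
      (fun h => hUV (by rw [h, SignedSet.support_opp])) a ⟨h1, h2⟩
    refine ⟨Z, hZ, fun b hb => ?_⟩
    rcases hb with hb | hb
    · obtain ⟨h | h, h'⟩ := hp hb
      · exact ⟨Or.inl (Or.inl h), h'⟩
      · exact ⟨Or.inr (Or.inl h), h'⟩
    · obtain ⟨h | h, h'⟩ := hn hb
      · exact ⟨Or.inl (Or.inr h), h'⟩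
      · exact ⟨Or.inr (Or.inr h), h'⟩
  rcases haX with h1 | h1 <;> rcases haY with h2 | h2
  · simpa [SignedSet.support_opp] using key X hX Y.opp (N.opp_mem Y hY)
      (by rwa [SignedSet.support_opp]) h1 h2
  · exact key X hX Y hY hXY h1 h2
  · simpa [SignedSet.support_opp] using key X.opp (N.opp_mem X hX) Y.opp (N.opp_mem Y hY)
      (by rwa [SignedSet.support_opp, SignedSet.support_opp]) h1 h2
  · simpa [SignedSet.support_opp] using key X.opp (N.opp_mem X hX) Y hY
      (by rwa [SignedSet.support_opp]) h1 h2

theorem indep_aug [Finite A] (N : OrientedMatroid A) {I J : Set A} (hI : N.Indep I)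
    (hJ : N.Indep J) (hIJ : I.ncard < J.ncard) : ∃ e ∈ J, e ∉ I ∧ N.Indep (insert e I) := by
  by_contra hcon
  push Not at hcon
  -- among the independent subsets of `I ∪ J` with more elements than `I`, choose `K`
  -- such that `I \ K` is as small as possible
  obtain ⟨K, ⟨hK, hKsub, hKcard⟩, hmin⟩ := Set.exists_min_image
    {K : Set A | N.Indep K ∧ K ⊆ I ∪ J ∧ I.ncard < K.ncard} (fun K => (I \ K).ncard)
    (Set.toFinite _) ⟨J, hJ, Set.subset_union_right, hIJ⟩
  obtain ⟨g, hgK, hgI⟩ := Set.exists_mem_notMem_of_ncard_lt_ncard hKcard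
  have hne : ∃ e ∈ I, e ∉ K := by
    by_contra hIK
    push Not at hIK
    have hgJ : g ∈ J := (hKsub hgK).resolve_left hgI
    exact hcon g hgJ hgI fun X hX hsub =>
      hK X hX (hsub.trans (Set.insert_subset hgK hIK))
  obtain ⟨e, heI, heK⟩ := hne
  have hdep : ∀ f ∈ K, f ∉ I → ∃ X ∈ N.circuits, X.support ⊆ (insert e K) \ {f} := by
    intro f hfK hfI
    by_contra hno
    push Not at hno
    have hef : e ≠ f := fun h => hfI (h ▸ heI)
    have hcard : ((insert e K) \ {f}).ncard = K.ncard := by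
      rw [Set.ncard_sdiff_singleton_of_mem (Set.mem_insert_of_mem e hfK),
        Set.ncard_insert_of_notMem heK, Nat.add_sub_cancel]
    have hle := hmin ((insert e K) \ {f})
      ⟨hno, fun b hb => by
        rcases hb.1 with rfl | h
        · exact Or.inl heI
        · exact hKsub h, by rw [hcard]; exact hKcard⟩
    have hlt : (I \ ((insert e K) \ {f})).ncard < (I \ K).ncard := by
      refine Set.ncard_lt_ncard ⟨fun b hb => ⟨hb.1, fun hbK => hb.2
        ⟨Or.inr hbK, fun h => hfI (h ▸ hb.1)⟩⟩, fun h => ?_⟩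
      exact (h ⟨heI, heK⟩).2 ⟨Or.inl rfl, hef⟩
    omega
  have hmem : ∀ f, ∀ X ∈ N.circuits, X.support ⊆ (insert e K) \ {f} → e ∈ X.support := by
    intro f X hX hsub
    by_contra he
    refine hK X hX fun b hb => ?_
    rcases (hsub hb).1 with rfl | h
    · exact absurd hb he
    · exact h
  obtain ⟨X, hX, hXsub⟩ := hdep g hgK hgI
  have hh : ∃ h ∈ X.support, h ∉ I := by
    by_contra hno
    push Not at hno
    exact hI X hX hno
  obtain ⟨h, hhX, hhI⟩ := hh
  have hhK : h ∈ K := by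
    rcases (hXsub hhX).1 with rfl | h'
    · exact absurd heI hhI
    · exact h'
  obtain ⟨Y, hY, hYsub⟩ := hdep h hhK hhI
  have hXY : X.support ≠ Y.support := fun heq => (hYsub (heq ▸ hhX)).2 rfl
  obtain ⟨Z, hZ, hZsub⟩ := N.weak_elimination hX hY hXY (hmem g X hX hXsub) (hmem h Y hY hYsub)
  refine hK Z hZ fun b hb => ?_
  obtain ⟨hb1, hb2⟩ := hZsub hb
  have hb3 : b ∈ insert e K := by
    rcases hb1 with hb1 | hb1
    · exact (hXsub hb1).1
    · exact (hYsub hb1).1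
  exact hb3.resolve_left hb2

/-- The underlying (unoriented) matroid of an oriented matroid. -/
def underlying [Finite A] (N : OrientedMatroid A) : Matroid A :=
  (IndepMatroid.ofFinite (E := Set.univ) Set.finite_univ N.Indep
    (fun X hX hsub => N.empty_notMem (by
      have h0 := Set.subset_empty_iff.1 hsub
      have hX0 : X = SignedSet.empty A := SignedSet.ext
        (Set.subset_empty_iff.1 (h0 ▸ Set.subset_union_left))
        (Set.subset_empty_iff.1 (h0 ▸ Set.subset_union_right))
      exact hX0 ▸ hX))
    (fun _ _ hJ hIJ X hX hsub => hJ X hX (hsub.trans hIJ))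
    (fun _ _ hI hJ hIJ => N.indep_aug hI hJ hIJ)
    (fun _ _ => Set.subset_univ _)).matroid

/-- The circuits of the underlying matroid are the supports of the signed circuits. -/
theorem underlying_isCircuit_iff [Finite A] (N : OrientedMatroid A) (C : Set A) :
    N.underlying.IsCircuit C ↔ ∃ X ∈ N.circuits, X.support = C := by
  have hdep : ∀ D : Set A, N.underlying.Dep D ↔ ∃ X ∈ N.circuits, X.support ⊆ D := by
    intro D
    have h1 : N.underlying.Dep D ↔ ¬ N.Indep D :=
      ⟨fun h => h.1, fun h => ⟨h, Set.subset_univ D⟩⟩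
    rw [h1]
    simp [Indep]
  constructor
  · intro h
    obtain ⟨X, hX, hsub⟩ := (hdep C).1 h.dep
    exact ⟨X, hX, h.eq_of_dep_subset ((hdep _).2 ⟨X, hX, subset_rfl⟩) hsub⟩
  · rintro ⟨X, hX, rfl⟩
    rw [Matroid.isCircuit_iff]
    refine ⟨(hdep _).2 ⟨X, hX, subset_rfl⟩, fun D hD hsub => hsub.antisymm ?_⟩
    obtain ⟨Y, hY, hYD⟩ := (hdep D).1 hD
    have hYX : Y.support = X.support := by
      rcases N.incomparable Y hY X hX (hYD.trans hsub) with h | h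
      · rw [h]
      · rw [h, SignedSet.support_opp]
    exact hYX ▸ hYD

/-- The oriented matroid `₋S N` obtained from `N` by reorienting the elements of `S`. -/
def reorient (N : OrientedMatroid A) (S : Set A) : OrientedMatroid A where
  circuits := (fun X : SignedSet A => X.reorient S) '' N.circuits
  empty_notMem := by
    rintro ⟨X, hX, h⟩
    have h0 : X.support = ∅ := by
      have h' : X.reorient S = SignedSet.empty A := h
      rw [← SignedSet.support_reorient X S, h']
      exact Set.union_empty ∅
    refine N.empty_notMem ?_
    have hX0 : X = SignedSet.empty A := SignedSet.ext
      (Set.subset_empty_iff.1 (h0 ▸ Set.subset_union_left))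
      (Set.subset_empty_iff.1 (h0 ▸ Set.subset_union_right))
    exact hX0 ▸ hX
  opp_mem := by
    rintro _ ⟨X, hX, rfl⟩
    exact ⟨X.opp, N.opp_mem X hX, rfl⟩
  incomparable := by
    rintro _ ⟨X, hX, rfl⟩ _ ⟨Y, hY, rfl⟩ h
    simp only [SignedSet.support_reorient] at h
    rcases N.incomparable X hX Y hY h with rfl | rfl
    · exact Or.inl rfl
    · exact Or.inr rfl
  elimination := by
    rintro _ ⟨X, hX, rfl⟩ _ ⟨Y, hY, rfl⟩ hne a ha
    have hXY : X ≠ Y.opp := by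
      rintro rfl
      exact hne rfl
    have hYX : Y ≠ X.opp := by
      rintro rfl
      exact hne rfl
    have push : ∀ Z : SignedSet A, Z.pos ⊆ (X.pos ∪ Y.pos) \ {a} →
        Z.neg ⊆ (X.neg ∪ Y.neg) \ {a} →
        (Z.reorient S).pos ⊆ ((X.reorient S).pos ∪ (Y.reorient S).pos) \ {a} ∧
        (Z.reorient S).neg ⊆ ((X.reorient S).neg ∪ (Y.reorient S).neg) \ {a} := by
      intro Z hp hn
      constructor <;> intro b hb
      all_goals
        have h1 := @hp b
        have h2 := @hn b
        simp only [SignedSet.reorient, Set.mem_union, Set.mem_sdiff, Set.mem_inter_iff,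
          Set.mem_singleton_iff] at hb h1 h2 ⊢
        tauto
    by_cases haS : a ∈ S
    · have hX' : a ∈ X.neg := by
        have := ha.1
        simp only [SignedSet.reorient, Set.mem_union, Set.mem_sdiff, Set.mem_inter_iff] at this
        tauto
      have hY' : a ∈ Y.pos := by
        have := ha.2
        simp only [SignedSet.reorient, Set.mem_union, Set.mem_sdiff, Set.mem_inter_iff] at this
        tauto
      obtain ⟨Z, hZ, hp, hn⟩ := N.elimination Y hY X hX hYX a ⟨hY', hX'⟩
      rw [Set.union_comm] at hp hn
      exact ⟨_, ⟨Z, hZ, rfl⟩, push Z hp hn⟩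
    · have hX' : a ∈ X.pos := by
        have := ha.1
        simp only [SignedSet.reorient, Set.mem_union, Set.mem_sdiff, Set.mem_inter_iff] at this
        tauto
      have hY' : a ∈ Y.neg := by
        have := ha.2
        simp only [SignedSet.reorient, Set.mem_union, Set.mem_sdiff, Set.mem_inter_iff] at this
        tauto
      obtain ⟨Z, hZ, hp, hn⟩ := N.elimination X hX Y hY hXY a ⟨hX', hY'⟩
      exact ⟨_, ⟨Z, hZ, rfl⟩, push Z hp hn⟩

/-- `N` is represented by the real matrix `R`, whose columns are labelled by `A`: the circuits of
the underlying matroid are the minimal sets indexing linearly dependent columns, and every signed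
circuit is the sign pattern of a linear relation between the columns. -/
def RepresentedBy [Fintype A] (N : OrientedMatroid A) {m : ℕ} (R : Matrix (Fin m) A ℝ) : Prop :=
  (∀ C : Set A, N.underlying.IsCircuit C ↔
      Minimal (fun D : Set A => ¬ LinearIndepOn ℝ R.transpose D) C) ∧
    ∀ X ∈ N.circuits, ∃ k : A → ℝ, (∀ a ∈ X.support, 0 < k a) ∧
      ∑ a, (X.vec a * k a) • R.transpose a = 0

/-- `N` is regular: it is represented over `ℝ` by a totally unimodular matrix. -/
def IsRegular [Fintype A] (N : OrientedMatroid A) : Prop :=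
  ∃ (m : ℕ) (R : Matrix (Fin m) A ℝ), R.IsTotallyUnimodular ∧ N.RepresentedBy R

/-- The signed cocircuits of `N`: the signed sets supported on a cocircuit of the
underlying matroid which are orthogonal to every signed circuit. -/
def IsSignedCocircuit [Finite A] (N : OrientedMatroid A) (Y : SignedSet A) : Prop :=
  N.underlying.IsCocircuit Y.support ∧ ∀ X ∈ N.circuits, X.Orthogonal Y

/-- `D` is (the support of) a positive cocircuit of `N`. -/
def IsPositiveCocircuit [Finite A] (N : OrientedMatroid A) (D : Set A) : Prop :=
  ∃ Y : SignedSet A, N.IsSignedCocircuit Y ∧ Y.neg = ∅ ∧ Y.support = D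

/-- A cocycle of the underlying matroid: a disjoint union of cocircuits. -/
def IsCocycle [Finite A] (N : OrientedMatroid A) (S : Set A) : Prop :=
  ∃ F : Set (Set A), (∀ D ∈ F, N.underlying.IsCocircuit D) ∧ F.PairwiseDisjoint id ∧ ⋃₀ F = S

/-- A positive cocycle: a disjoint union of (supports of) positive cocircuits. -/
def IsPositiveCocycle [Finite A] (N : OrientedMatroid A) (S : Set A) : Prop :=
  ∃ F : Set (Set A), (∀ D ∈ F, N.IsPositiveCocircuit D) ∧ F.PairwiseDisjoint id ∧ ⋃₀ F = S

/-- `N` is acyclic: every element belongs to a positive cocircuit. -/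
def IsAcyclic [Finite A] (N : OrientedMatroid A) : Prop :=
  ∀ a : A, ∃ D : Set A, N.IsPositiveCocircuit D ∧ a ∈ D

/-- The class `[₋S N]` of the reorientation `₋S N` in the cocycle reversing system. As usual for
(labelled) orientations, a reorientation of `N` is recorded by the set of elements that have been
reversed, so the class consists of all `T` such that `₋T N` is obtained from `₋S N` by reorienting
a positive cocycle of `₋S N`; that cocycle is the symmetric difference of `S` and `T`. -/
def cocycleClass [Finite A] (N : OrientedMatroid A) (S : Set A) : Set (Set A) :=
  {T | (N.reorient S).IsPositiveCocycle (symmDiff S T)}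

/-- The set of all classes `[₋S N]`, where `S` is a cocycle of the underlying matroid. -/
def cocycleClasses [Finite A] (N : OrientedMatroid A) : Set (Set (Set A)) :=
  {K | ∃ S : Set A, N.IsCocycle S ∧ K = N.cocycleClass S}

/-- An acyclic class: all the reorientations in the class are acyclic. -/
def IsAcyclicClass [Finite A] (N : OrientedMatroid A) (K : Set (Set A)) : Prop :=
  ∀ T ∈ K, (N.reorient T).IsAcyclic

/-- The set `Π_N` of the points of `[0, 1/2]^A` whose inner product with the incidence vector of
every circuit is an integer. -/
def weakPoints [Fintype A] (N : OrientedMatroid A) : Set (A → ℝ) :=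
  {x | (∀ a, 0 ≤ x a ∧ x a ≤ 1 / 2) ∧ ∀ C ∈ N.circuits, ∃ n : ℤ, C.vec ⬝ᵥ x = n}

/-- The set `Π_N^>` of the points of `(0, 1/2)^A` whose inner product with the incidence vector of
every circuit is an integer. -/
def strictPoints [Fintype A] (N : OrientedMatroid A) : Set (A → ℝ) :=
  {x | (∀ a, 0 < x a ∧ x a < 1 / 2) ∧ ∀ C ∈ N.circuits, ∃ n : ℤ, C.vec ⬝ᵥ x = n}

/-- `α = α_x`, that is, `α` sends every circuit to the inner product of its incidence vector
with `x`. -/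
def IsValueMap [Fintype A] (N : OrientedMatroid A) (x : A → ℝ) (α : N.circuits → ℤ) : Prop :=
  ∀ C : N.circuits, C.1.vec ⬝ᵥ x = α C

/-- The set `Ω_N^≥` of the maps `α_x` for `x ∈ Π_N`. -/
def weakOmega [Fintype A] (N : OrientedMatroid A) : Set (N.circuits → ℤ) :=
  {α | ∃ x ∈ N.weakPoints, N.IsValueMap x α}

/-- The set `Ω_N^>` of the maps `α_x` for `x ∈ Π_N^>`. -/
def strictOmega [Fintype A] (N : OrientedMatroid A) : Set (N.circuits → ℤ) :=
  {α | ∃ x ∈ N.strictPoints, N.IsValueMap x α}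

/-- The polytope `Π_{N,α}` of the points `x ∈ Π_N` such that `α_x = α`. -/
def polytope [Fintype A] (N : OrientedMatroid A) (α : N.circuits → ℤ) : Set (A → ℝ) :=
  {x | x ∈ N.weakPoints ∧ N.IsValueMap x α}

/-- The set of vertices of the polytope `Π_{N,α}`. -/
def vertices [Fintype A] (N : OrientedMatroid A) (α : N.circuits → ℤ) : Set (A → ℝ) :=
  (N.polytope α).extremePoints ℝ

/-- The set `S(x)` of the coordinates of `x` which are equal to `1/2`. -/
def halfSet (x : A → ℝ) : Set A := {a | x a = 1 / 2}

end OrientedMatroid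

/-! Let W be the space `cutSpace` of vectors orthogonal to all signed circuits. Two points of the
cube have the same circuit values exactly when they differ by an element of W, so each polytope is
the intersection of the cube [0,1/2]^A with a translate of W. The proof identifies the classes of
the cocycle reversing system with the same translates.

Regularity makes W combinatorial. By Cramer's rule and total unimodularity, incidence vectors of
circuits lie in the kernel of the matrix (`RepresentedBy.mulVec_vec`). Hence W is determined by the
fundamental circuits of a base, incidence vectors of signed cocircuits lie in W, and each nonzero
coordinate of a vector of W is covered by a signed cocircuit conforming to it
(`exists_isSignedCocircuit_conforms`).

At a vertex x, the fractional coordinates contain no cocircuit, since otherwise x could be moved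
both ways along W. So some circuit meets them in one prescribed element, and integrality forbids a
value strictly between 0 and 1/2 there. The vertices of the cube with integral circuit values are
the points `halfPoint S` with S a cocycle (`isCocycle_iff`).

Reversing a positive cocycle to pass from S to T means precisely that `halfPoint T - halfPoint S`
lies in W (`mem_cocycleClass_iff`). Thus classes and value maps both label translates of W through
such cube vertices, which gives the bijection. Acyclicity means that the translate meets the open
cube: a sum of positive cocircuits covering A points inward, and conversely an inward direction in W
is covered by positive cocircuits. -/

/-! ### Cramer's rule for totally unimodular matrices -/

open Matrix in
/-- In a totally unimodular matrix, the coordinates of a column with respect to a family of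
linearly independent columns are `0`, `1` or `-1`. -/
theorem Matrix.IsTotallyUnimodular.coord_mem_range {A : Type*} [Fintype A] {m : ℕ}
    {R : Matrix (Fin m) A ℝ} (hR : R.IsTotallyUnimodular) {I : Set A}
    (hI : LinearIndepOn ℝ R.transpose I) {e : A} {u : A → ℝ} (hu : ∀ a ∉ I, u a = 0)
    (hue : R *ᵥ u = R.transpose e) (a : A) : u a ∈ Set.range (SignType.cast : SignType → ℝ) := by
  classical
  by_cases haI : a ∉ I
  · exact ⟨0, by simp [hu a haI]⟩
  push Not at haI
  let M : Matrix (Fin m) I ℝ := R.submatrix id (↑)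
  -- Rows forming a basis of the row space of the columns in `I`. Since row rank equals column rank,
  -- they cut out a nonsingular square submatrix, and `u a` becomes a quotient of two minors.
  obtain ⟨κ, g, hg, hspan, hli⟩ := exists_linearIndependent' ℝ M.row
  have : Finite κ := Finite.of_injective g hg
  have := Fintype.ofFinite κ
  have hrank : M.rank = Fintype.card I := by
    rw [← Matrix.rank_transpose]
    exact LinearIndependent.rank_matrix (M := Mᵀ) hI
  have hcard : Fintype.card I = Fintype.card κ := by
    rw [← hrank, Matrix.rank_eq_finrank_span_row, ← hspan, finrank_span_eq_card hli]
  let f : I ≃ κ := Fintype.equivOfCardEq hcard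
  let M' : Matrix I I ℝ := R.submatrix (g ∘ f) (↑)
  have hunit : IsUnit M' := by
    rw [← Matrix.linearIndependent_rows_iff_isUnit]
    exact hli.comp f f.injective
  have hTU := (Matrix.isTotallyUnimodular_iff_fintype R).1 hR
  have hdet0 : M'.det ≠ 0 := ((Matrix.isUnit_iff_isUnit_det _).1 hunit).ne_zero
  obtain ⟨s, hs⟩ := hTU I (g ∘ f) (↑)
  -- The numerator in Cramer's rule: column `a` is replaced by column `e`, so it is again a minor of
  -- `R`.
  obtain ⟨t, ht⟩ := hTU I (g ∘ f) (fun j => if j = ⟨a, haI⟩ then e else j)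
  have hb : M' *ᵥ (fun i : I => u i) = fun i => R (g (f i)) e := by
    funext i
    have h1 := congrFun hue (g (f i))
    rw [Matrix.transpose_apply] at h1
    rw [← h1]
    simp only [Matrix.mulVec, dotProduct, M', Matrix.submatrix_apply, Function.comp]
    refine Fintype.sum_of_injective Subtype.val Subtype.val_injective _ _ (fun j hj => ?_)
      (fun _ => rfl)
    rw [hu j (fun h => hj ⟨⟨j, h⟩, rfl⟩), mul_zero]
  have hcr : M'.cramer (fun i => R (g (f i)) e) ⟨a, haI⟩ = M'.det * u a := by
    rw [← hb, Matrix.cramer_eq_adjugate_mulVec, Matrix.mulVec_mulVec, Matrix.adjugate_mul]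
    simp [Matrix.smul_mulVec]
  have hup : M'.cramer (fun i => R (g (f i)) e) ⟨a, haI⟩ = t.cast := by
    rw [ht, Matrix.cramer_apply]
    congr 1
    ext i j
    simp only [Matrix.updateCol_apply, Matrix.submatrix_apply, Function.comp, M']
    split_ifs <;> rfl
  rw [hup] at hcr
  change _ = M'.det at hs
  rw [← hs] at hcr hdet0
  have hss : (s : ℝ) * s = 1 := by
    rcases s with _ | _ | _
    · exact absurd rfl hdet0
    · change (-1 : ℝ) * -1 = 1
      norm_num
    · exact mul_one (1 : ℝ)
  exact ⟨s * t, by rw [SignType.coe_mul, hcr, ← mul_assoc, hss, one_mul]⟩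

/-! ### Incidence vectors and the kernel of the representing matrix -/

namespace OrientedMatroid

open SignedSet

variable {A : Type*}

theorem _root_.SignedSet.vec_of_mem_pos {X : SignedSet A} {a : A} (h : a ∈ X.pos) :
    X.vec a = 1 := by
  simp [vec, h, Set.disjoint_left.1 X.disj h]

theorem _root_.SignedSet.vec_of_mem_neg {X : SignedSet A} {a : A} (h : a ∈ X.neg) :
    X.vec a = -1 := by
  simp [vec, h, Set.disjoint_right.1 X.disj h]

theorem _root_.SignedSet.vec_of_notMem {X : SignedSet A} {a : A} (h : a ∉ X.support) :
    X.vec a = 0 := by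
  simp only [support, Set.mem_union, not_or] at h
  simp [vec, h]

theorem _root_.SignedSet.vec_opp (X : SignedSet A) : X.opp.vec = -X.vec := by
  funext a
  simp [vec, opp]

theorem _root_.SignedSet.vec_eq_one_or (X : SignedSet A) {a : A} (h : a ∈ X.support) :
    X.vec a = 1 ∨ X.vec a = -1 :=
  h.imp vec_of_mem_pos vec_of_mem_neg

theorem _root_.SignedSet.vec_pos_iff {X : SignedSet A} {a : A} : 0 < X.vec a ↔ a ∈ X.pos := by
  by_cases h : a ∈ X.pos
  · simp [vec_of_mem_pos h, h]
  · by_cases h' : a ∈ X.neg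
    · simp only [vec_of_mem_neg h', h, iff_false]; norm_num
    · rw [vec_of_notMem (by simp [support, h, h'])]; simp [h]

theorem _root_.SignedSet.vec_neg_iff {X : SignedSet A} {a : A} : X.vec a < 0 ↔ a ∈ X.neg := by
  have := vec_pos_iff (X := X.opp) (a := a)
  rw [vec_opp] at this
  simpa [opp] using this

theorem _root_.SignedSet.vec_eq_zero_iff {X : SignedSet A} {a : A} :
    X.vec a = 0 ↔ a ∉ X.support := by
  refine ⟨fun h ha => ?_, vec_of_notMem⟩
  rcases X.vec_eq_one_or ha with h' | h' <;> rw [h] at h' <;> norm_num at h'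

theorem _root_.SignedSet.orthogonal_iff {X Y : SignedSet A} :
    X.Orthogonal Y ↔ ((∃ a, 0 < X.vec a * Y.vec a) ↔ ∃ a, X.vec a * Y.vec a < 0) := by
  simp only [Orthogonal, mul_pos_iff, mul_neg_iff, vec_pos_iff, vec_neg_iff]
  rfl

variable [Fintype A]

open Matrix

theorem RepresentedBy.indep_iff {N : OrientedMatroid A} {m : ℕ} {R : Matrix (Fin m) A ℝ}
    (h : N.RepresentedBy R) (I : Set A) :
    N.underlying.Indep I ↔ LinearIndepOn ℝ R.transpose I := by
  rw [Matroid.indep_iff_forall_subset_not_isCircuit (show I ⊆ N.underlying.E from I.subset_univ)]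
  constructor
  · intro hI
    by_contra hdep
    obtain ⟨C, hCI, hC⟩ := exists_minimal_le_of_wellFoundedLT
      (fun D : Set A => ¬ LinearIndepOn ℝ R.transpose D) I hdep
    exact hI C hCI ((h.1 C).2 hC)
  · exact fun hI C hCI hC => ((h.1 C).1 hC).prop (hI.mono hCI)

/-- Solving the given relation for one column of the circuit expresses it through independent
columns, with coefficients 0, 1 or -1 by total unimodularity. The positive weights `k` are therefore
all equal and can be divided out. -/
theorem RepresentedBy.mulVec_vec {N : OrientedMatroid A} {m : ℕ} {R : Matrix (Fin m) A ℝ}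
    (h : N.RepresentedBy R) (hR : R.IsTotallyUnimodular) {X : SignedSet A}
    (hX : X ∈ N.circuits) : R *ᵥ X.vec = 0 := by
  classical
  obtain ⟨k, hk, hsum⟩ := h.2 X hX
  have hC : N.underlying.IsCircuit X.support := (N.underlying_isCircuit_iff _).2 ⟨X, hX, rfl⟩
  obtain ⟨e, he⟩ := hC.nonempty
  have hI := (h.indep_iff _).1 (hC.sdiff_singleton_indep he)
  have hker : R *ᵥ (fun a => X.vec a * k a) = 0 := by
    rw [← hsum]
    funext i
    simp [Matrix.mulVec, dotProduct, mul_comm]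
  have hve : X.vec e * k e ≠ 0 :=
    mul_ne_zero (fun h0 => vec_eq_zero_iff.1 h0 he) (hk e he).ne'
  let u : A → ℝ := fun a => if a = e then 0 else -(X.vec a * k a) / (X.vec e * k e)
  have hu : (fun a => X.vec a * k a) = (X.vec e * k e) • (Pi.single e 1 - u) := by
    funext a
    by_cases hae : a = e
    · subst hae; simp [u]
    · simp only [u, Pi.smul_apply, Pi.sub_apply, smul_eq_mul, hae, if_false, ne_eq,
        not_false_eq_true, Pi.single_eq_of_ne]
      rw [zero_sub, neg_div, neg_neg, mul_div_cancel₀ _ hve]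
  have hue : R *ᵥ u = R.transpose e := by
    rw [hu, Matrix.mulVec_smul, smul_eq_zero] at hker
    have := hker.resolve_left hve
    rw [Matrix.mulVec_sub, sub_eq_zero] at this
    rw [← this]
    simp
    rfl
  have hmem := hR.coord_mem_range hI (u := u) (fun a ha => by
    by_cases hae : a = e
    · simp [u, hae]
    · have : a ∉ X.support := fun h => ha ⟨h, hae⟩
      simp [u, vec_of_notMem this]) hue
  have hconst : ∀ a ∈ X.support, k a = k e := by
    intro a ha
    by_cases hae : a = e
    · rw [hae]
    have h1 := hk a ha
    have h2 := hk e he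
    obtain ⟨s, hs⟩ := hmem a
    simp only [u, if_neg hae] at hs
    rw [eq_div_iff hve] at hs
    rcases X.vec_eq_one_or ha with h3 | h3 <;> rcases X.vec_eq_one_or he with h4 | h4 <;>
      rw [h3, h4] at hs <;> rcases s with _ | _ | _ <;> simp at hs <;> linarith
  have : (fun a => X.vec a * k a) = k e • X.vec := by
    funext a
    by_cases ha : a ∈ X.support
    · simp [hconst a ha, mul_comm]
    · simp [vec_of_notMem ha]
  rw [this, Matrix.mulVec_smul, smul_eq_zero] at hker
  exact hker.resolve_left (hk e he).ne'

end OrientedMatroid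

/-! ### The cut space, bases and cocircuits -/

namespace OrientedMatroid

open SignedSet Matrix

variable {A : Type*} [Fintype A]

/-- The space of the vectors orthogonal to the incidence vectors of all signed circuits. -/
def cutSpace (N : OrientedMatroid A) : Submodule ℝ (A → ℝ) where
  carrier := {y | ∀ X ∈ N.circuits, X.vec ⬝ᵥ y = 0}
  zero_mem' := fun X _ => dotProduct_zero _
  add_mem' := fun hy hz X hX => by rw [dotProduct_add, hy X hX, hz X hX, add_zero]
  smul_mem' := fun t y hy X hX => by rw [dotProduct_smul, hy X hX, smul_zero]

theorem exists_fundamental_signedCircuit (N : OrientedMatroid A) {B : Set A}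
    (hB : N.underlying.IsBase B) {d : A} (hd : d ∉ B) :
    ∃ X ∈ N.circuits, X.support ⊆ insert d B ∧ X.vec d = 1 := by
  obtain ⟨X, hX, hXs⟩ := (N.underlying_isCircuit_iff _).1
    (hB.fundCircuit_isCircuit (x := d) (Set.mem_univ d) hd)
  have hsub : X.support ⊆ insert d B := hXs ▸ Matroid.fundCircuit_subset_insert _ _ _
  have hdX : d ∈ X.support := hXs ▸ Matroid.mem_fundCircuit _ _ _
  rcases X.vec_eq_one_or hdX with h | h
  · exact ⟨X, hX, hsub, h⟩
  · exact ⟨X.opp, N.opp_mem X hX, by rwa [support_opp], by rw [vec_opp, Pi.neg_apply, h, neg_neg]⟩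

/-- A vector orthogonal to the fundamental circuits of a base is orthogonal to all circuits. -/
theorem mem_cutSpace_of_isBase {N : OrientedMatroid A} (hN : N.IsRegular) {B : Set A}
    (hB : N.underlying.IsBase B) {c : A → SignedSet A} (hc : ∀ d ∉ B, c d ∈ N.circuits)
    (hs : ∀ d ∉ B, (c d).support ⊆ insert d B) (h1 : ∀ d ∉ B, (c d).vec d = 1) {y : A → ℝ}
    (hy : ∀ d ∉ B, (c d).vec ⬝ᵥ y = 0) : y ∈ N.cutSpace := by
  classical
  obtain ⟨m, R, hR, hNR⟩ := hN
  intro X hX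
  -- The combination of fundamental circuits that agrees with `X` off `B`. The difference is a
  -- relation among the independent columns of `B`, hence zero.
  let w : A → ℝ := ∑ d with d ∉ B, X.vec d • (c d).vec
  have hker : R *ᵥ (X.vec - w) = 0 := by
    rw [Matrix.mulVec_sub, hNR.mulVec_vec hR hX, zero_sub, neg_eq_zero]
    simp only [w, Matrix.mulVec_sum, Matrix.mulVec_smul]
    refine Finset.sum_eq_zero fun d hd => ?_
    rw [hNR.mulVec_vec hR (hc d (Finset.mem_filter.1 hd).2), smul_zero]
  have hoff : ∀ a ∉ B, (X.vec - w) a = 0 := by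
    intro a ha
    have : w a = X.vec a := by
      simp only [w, Finset.sum_apply, Pi.smul_apply, smul_eq_mul]
      rw [Finset.sum_eq_single_of_mem a (by simpa using ha)]
      · rw [h1 a ha, mul_one]
      · intro d hd hda
        have hd' := (Finset.mem_filter.1 hd).2
        rw [vec_of_notMem (X := c d), mul_zero]
        exact fun h => (hs d hd' h).elim (fun h => hda h.symm) ha
    rw [Pi.sub_apply, this, sub_self]
  have hli := linearIndepOn_iff''.1 ((hNR.indep_iff B).1 hB.indep) (Finset.univ.filter (· ∈ B))
    (X.vec - w) (by intro a; simp) (by simpa using hoff) (by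
      rw [Finset.sum_filter_of_ne]
      · rw [← hker]
        funext i
        simp [Matrix.mulVec, dotProduct, mul_comm]
      · intro a _ ha
        by_contra h
        exact ha (by rw [hoff a h, zero_smul]))
  have hXw : X.vec = w := by
    funext a
    by_cases ha : a ∈ B
    · exact sub_eq_zero.1 (hli a (by simpa using ha))
    · exact sub_eq_zero.1 (hoff a ha)
  rw [hXw]
  simp only [w, sum_dotProduct, smul_dotProduct]
  refine Finset.sum_eq_zero fun d hd => ?_
  rw [hy d (Finset.mem_filter.1 hd).2, smul_zero]

/-- By minimality of a cocircuit, `D \ {e}` is coindependent, so some base avoids it. That base must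
still meet `D`, and can only do so in `e`. -/
theorem exists_isBase_inter_eq_singleton {N : OrientedMatroid A} {D : Set A}
    (hD : N.underlying.IsCocircuit D) {e : A} (he : e ∈ D) :
    ∃ B, N.underlying.IsBase B ∧ B ∩ D = {e} := by
  have hco : N.underlying.Coindep (D \ {e}) := hD.isCircuit.sdiff_singleton_indep he
  obtain ⟨B, hB, hBD⟩ := hco.exists_isBase_subset_compl
  obtain ⟨f, hfD, hfB⟩ := (Matroid.isCocircuit_iff_minimal.1 hD).prop B hB
  refine ⟨B, hB, ?_⟩
  have hfe : ∀ f ∈ B ∩ D, f = e := fun f hf => by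
    by_contra h
    exact (hBD hf.1).2 ⟨hf.2, h⟩
  exact Set.eq_singleton_iff_unique_mem.2 ⟨hfe f ⟨hfB, hfD⟩ ▸ ⟨hfB, hfD⟩, hfe⟩

/-- A nonzero vector of the cut space does not vanish on all of the elements of a base. -/
theorem eq_zero_of_isBase {N : OrientedMatroid A} {y : A → ℝ} (hy : y ∈ N.cutSpace) {B : Set A}
    (hB : N.underlying.IsBase B) (hyB : ∀ a ∈ B, y a = 0) : y = 0 := by
  funext d
  by_cases hd : d ∈ B
  · exact hyB d hd
  obtain ⟨X, hX, hs, h1⟩ := N.exists_fundamental_signedCircuit hB hd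
  have := hy X hX
  rw [dotProduct, Finset.sum_eq_single_of_mem d (Finset.mem_univ d), h1, one_mul] at this
  · exact this
  · intro a _ had
    by_cases ha : a ∈ B
    · rw [hyB a ha, mul_zero]
    · rw [vec_of_notMem (fun h => (hs h).elim had ha), zero_mul]

/-- Otherwise the support is coindependent and some base avoids it, but a vector of the cut space
vanishing on a base is zero. -/
theorem exists_isCocircuit_subset_of_mem_cutSpace {N : OrientedMatroid A} {y : A → ℝ}
    (hy : y ∈ N.cutSpace) (hy0 : y ≠ 0) :
    ∃ D, N.underlying.IsCocircuit D ∧ D ⊆ Function.support y := by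
  by_contra hcon
  push Not at hcon
  have hco : N.underlying.Coindep (Function.support y) :=
    Matroid.coindep_iff_forall_subset_not_isCocircuit.2
      ⟨fun K hK hKc => hcon K hKc hK, Set.subset_univ _⟩
  obtain ⟨B, hB, hBD⟩ := hco.exists_isBase_subset_compl
  exact hy0 (eq_zero_of_isBase hy hB fun a ha => Function.notMem_support.1 (hBD ha).2)

/-- Take a base meeting `D` only in `e`, prescribe 1 at `e` and 0 elsewhere on the base, and let the
fundamental circuits dictate the other values. A nonzero value off `D` would give a circuit meeting
the cocircuit `D` only in `e`, which is impossible. -/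
theorem exists_mem_cutSpace_support_subset {N : OrientedMatroid A} (hN : N.IsRegular) {D : Set A}
    (hD : N.underlying.IsCocircuit D) :
    ∃ y ∈ N.cutSpace, y ≠ 0 ∧ Function.support y ⊆ D := by
  classical
  obtain ⟨e, he⟩ := hD.nonempty
  obtain ⟨B, hB, hBD⟩ := exists_isBase_inter_eq_singleton hD he
  have heB : e ∈ B := (hBD.symm.subset rfl).1
  have hex : ∀ d, ∃ X : SignedSet A, d ∉ B → X ∈ N.circuits ∧ X.support ⊆ insert d B ∧
      X.vec d = 1 := by
    intro d
    by_cases hd : d ∈ B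
    · exact ⟨SignedSet.empty A, fun h => absurd hd h⟩
    · obtain ⟨X, hX⟩ := N.exists_fundamental_signedCircuit hB hd
      exact ⟨X, fun _ => hX⟩
  choose c hc using hex
  let y : A → ℝ := fun d => if d = e then 1 else if d ∈ B then 0 else -(c d).vec e
  have hye : y e = 1 := if_pos rfl
  refine ⟨y, mem_cutSpace_of_isBase hN hB (fun d hd => (hc d hd).1) (fun d hd => (hc d hd).2.1)
    (fun d hd => (hc d hd).2.2) fun d hd => ?_, fun h => by simp [h] at hye, fun d hd => ?_⟩
  · have hde : d ≠ e := fun h => hd (h ▸ heB)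
    rw [dotProduct, Finset.sum_eq_add d e hde]
    · rw [(hc d hd).2.2, hye]
      simp [y, hde, hd]
    · rintro a - ⟨had, hae⟩
      by_cases haB : a ∈ B
      · simp [y, hae, haB]
      · rw [vec_of_notMem (fun h => ((hc d hd).2.1 h).elim had haB), zero_mul]
    · simp
    · simp
  · by_contra hdD
    have hde : d ≠ e := fun h => hdD (h ▸ he)
    have hdB : d ∉ B := fun h => hd (by simp [y, hde, h])
    have hce : e ∈ (c d).support := by
      by_contra h
      exact hd (by simp [y, hde, hdB, vec_of_notMem h])
    refine ((N.underlying_isCircuit_iff _).2 ⟨c d, (hc d hdB).1, rfl⟩).inter_isCocircuit_ne_singleton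
      hD (e := e) (Set.eq_singleton_iff_unique_mem.2 ⟨⟨hce, he⟩, fun a ha => ?_⟩)
    rcases (hc d hdB).2.1 ha.1 with rfl | h
    · exact absurd ha.2 hdD
    · exact hBD.subset ⟨h, ha.2⟩

/-- The incidence vector of a signed cocircuit is orthogonal to all circuits. -/
theorem IsSignedCocircuit.vec_mem {N : OrientedMatroid A} (hN : N.IsRegular) {Y : SignedSet A}
    (hY : N.IsSignedCocircuit Y) : Y.vec ∈ N.cutSpace := by
  classical
  obtain ⟨e, he⟩ := hY.1.nonempty
  obtain ⟨B, hB, hBD⟩ := exists_isBase_inter_eq_singleton hY.1 he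
  have heB : e ∈ B := (hBD.symm.subset rfl).1
  have hex : ∀ d, ∃ X : SignedSet A, d ∉ B → X ∈ N.circuits ∧ X.support ⊆ insert d B ∧
      X.vec d = 1 := by
    intro d
    by_cases hd : d ∈ B
    · exact ⟨SignedSet.empty A, fun h => absurd hd h⟩
    · obtain ⟨X, hX⟩ := N.exists_fundamental_signedCircuit hB hd
      exact ⟨X, fun _ => hX⟩
  choose c hc using hex
  refine mem_cutSpace_of_isBase hN hB (fun d hd => (hc d hd).1) (fun d hd => (hc d hd).2.1)
    (fun d hd => (hc d hd).2.2) fun d hd => ?_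
  have hde : d ≠ e := fun h => hd (h ▸ heB)
  have h0 : ∀ a, a ≠ d → a ≠ e → (c d).vec a * Y.vec a = 0 := by
    intro a had hae
    by_cases haY : a ∈ Y.support
    · rw [vec_of_notMem, zero_mul]
      exact fun h => ((hc d hd).2.1 h).elim had fun h => hae (hBD.subset ⟨h, haY⟩)
    · rw [vec_of_notMem haY, mul_zero]
  rw [dotProduct, Finset.sum_eq_add d e hde (fun a _ h => h0 a h.1 h.2) (by simp) (by simp)]
  -- Only the terms at `d` and `e` remain, each in {0, 1, -1}. Orthogonality makes a positive term
  -- appear exactly when a negative one does, so the two cancel.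
  have horth := orthogonal_iff.1 (hY.2 _ (hc d hd).1)
  have hval : ∀ a, (c d).vec a * Y.vec a = 0 ∨ (c d).vec a * Y.vec a = 1 ∨
      (c d).vec a * Y.vec a = -1 := by
    intro a
    by_cases h1 : a ∈ Y.support
    · by_cases h2 : a ∈ (c d).support
      · rcases Y.vec_eq_one_or h1 with h3 | h3 <;> rcases (c d).vec_eq_one_or h2 with h4 | h4 <;>
          simp [h3, h4]
      · simp [vec_of_notMem h2]
    · simp [vec_of_notMem h1]
  have hlt : ∀ P : ℝ → Prop, ¬ P 0 → ((∃ a, P ((c d).vec a * Y.vec a)) ↔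
      P ((c d).vec d * Y.vec d) ∨ P ((c d).vec e * Y.vec e)) := by
    intro P hP
    constructor
    · rintro ⟨a, ha⟩
      by_cases had : a = d
      · exact Or.inl (had ▸ ha)
      by_cases hae : a = e
      · exact Or.inr (hae ▸ ha)
      · rw [h0 a had hae] at ha
        exact absurd ha hP
    · rintro (h | h)
      exacts [⟨d, h⟩, ⟨e, h⟩]
  rw [hlt (0 < ·) (lt_irrefl _), hlt (· < 0) (lt_irrefl _)] at horth
  rcases hval d with h | h | h <;> rcases hval e with h' | h' | h' <;> rw [h, h'] at horth ⊢ <;>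
    first | (norm_num at horth; done) | norm_num

end OrientedMatroid

/-! ### Conformal signed cocircuits in the cut space -/

namespace OrientedMatroid

open SignedSet Matrix

/-- `w` conforms to `z`: each nonzero coordinate of `w` has the sign of that coordinate of `z`. -/
def Conforms {A : Type*} (w z : A → ℝ) : Prop :=
  ∀ a, (0 < w a → 0 < z a) ∧ (w a < 0 → z a < 0)

variable {A : Type*}

theorem Conforms.refl (z : A → ℝ) : Conforms z z := fun _ => ⟨id, id⟩

theorem Conforms.trans {v w z : A → ℝ} (h : Conforms v w) (h' : Conforms w z) : Conforms v z :=
  fun a => ⟨fun hv => (h' a).1 ((h a).1 hv), fun hv => (h' a).2 ((h a).2 hv)⟩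

theorem Conforms.support_subset {w z : A → ℝ} (h : Conforms w z) :
    Function.support w ⊆ Function.support z := by
  intro a ha
  rcases lt_or_gt_of_ne (Function.mem_support.1 ha) with h' | h'
  · exact ((h a).2 h').ne
  · exact ((h a).1 h').ne'

/-- If `u` is supported in the support of `w` and has a sign opposite to that of `w` somewhere, one
can add a multiple of `u` to `w` until a coordinate vanishes, before any of them changes sign. -/
theorem exists_conforms_add_smul [Finite A] {w u : A → ℝ}
    (hsupp : Function.support u ⊆ Function.support w) {b : A} (hb : u b * w b < 0) :
    ∃ t : ℝ, 0 < t ∧ Conforms (w + t • u) w ∧ ∃ c, w c ≠ 0 ∧ (w + t • u) c = 0 := by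
  -- Ratio test: `c` is a coordinate that first reaches zero as `w` moves in the direction `u`.
  obtain ⟨c, hc, hmin⟩ := Set.exists_min_image {a | u a * w a < 0} (fun a => -w a / u a)
    (Set.toFinite _) ⟨b, hb⟩
  have hc' : u c * w c < 0 := hc
  have huc : u c ≠ 0 := fun h => by simp [h] at hc'
  have hwc : w c ≠ 0 := fun h => by simp [h] at hc'
  have ht : 0 < -w c / u c := by
    rcases mul_neg_iff.1 hc' with ⟨h1, h2⟩ | ⟨h1, h2⟩
    · exact div_pos (by linarith) h1
    · exact div_pos_of_neg_of_neg (by linarith) h1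
  refine ⟨-w c / u c, ht, fun a => ?_, c, hwc, ?_⟩
  · simp only [Pi.add_apply, Pi.smul_apply, smul_eq_mul]
    set t := -w c / u c
    by_cases hwa : w a = 0
    · have : u a = 0 := by
        by_contra h
        exact hsupp h hwa
      simp [hwa, this]
    by_cases ha : u a * w a < 0
    · have hle : t ≤ -w a / u a := hmin a ha
      rcases mul_neg_iff.1 ha with ⟨h1, h2⟩ | ⟨h1, h2⟩
      · rw [le_div_iff₀ h1] at hle
        exact ⟨fun h => by linarith, fun _ => h2⟩
      · rw [le_div_iff_of_neg h1] at hle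
        exact ⟨fun _ => h2, fun h => by linarith⟩
    · push Not at ha
      rcases lt_or_gt_of_ne hwa with h | h
      · have : u a ≤ 0 := by
          by_contra hu
          push Not at hu
          exact absurd (mul_neg_of_pos_of_neg hu h) (not_lt.2 ha)
        have := mul_nonpos_of_nonneg_of_nonpos ht.le this
        exact ⟨fun h' => by linarith, fun _ => h⟩
      · have : 0 ≤ u a := by
          by_contra hu
          push Not at hu
          exact absurd (mul_neg_of_neg_of_pos hu h) (not_lt.2 ha)
        have := mul_nonneg ht.le this
        exact ⟨fun _ => h, fun h' => by linarith⟩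
  · simp only [Pi.add_apply, Pi.smul_apply, smul_eq_mul]
    rw [div_mul_cancel₀ _ huc, add_neg_cancel]

/-- The signs of a real vector. -/
def signs (w : A → ℝ) : SignedSet A where
  pos := {a | 0 < w a}
  neg := {a | w a < 0}
  disj := Set.disjoint_left.2 fun _ h h' => lt_asymm (a := (0 : ℝ)) h h'

theorem support_signs (w : A → ℝ) : (signs w).support = Function.support w := by
  ext a
  simp only [signs, SignedSet.support, Set.mem_union, Set.mem_ofPred_eq, Function.mem_support]
  rw [or_comm, ne_iff_lt_or_gt]

variable [Fintype A]

/-- A vanishing sum has a positive term exactly when it has a negative one. -/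
theorem orthogonal_signs_of_dotProduct_eq_zero {X : SignedSet A} {w : A → ℝ}
    (h : X.vec ⬝ᵥ w = 0) : X.Orthogonal (signs w) := by
  have hpos : (∃ a, 0 < X.vec a * (signs w).vec a) ↔ ∃ a, 0 < X.vec a * w a := by
    simp only [mul_pos_iff, vec_pos_iff, vec_neg_iff]
    rfl
  have hneg : (∃ a, X.vec a * (signs w).vec a < 0) ↔ ∃ a, X.vec a * w a < 0 := by
    simp only [mul_neg_iff, vec_pos_iff, vec_neg_iff]
    rfl
  rw [orthogonal_iff, hpos, hneg]
  constructor
  · rintro ⟨a, ha⟩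
    by_contra hcon
    push Not at hcon
    exact ((Finset.sum_pos' (fun b _ => hcon b) ⟨a, Finset.mem_univ a, ha⟩).ne' h)
  · rintro ⟨a, ha⟩
    by_contra hcon
    push Not at hcon
    exact ((Finset.sum_neg' (fun b _ => hcon b) ⟨a, Finset.mem_univ a, ha⟩).ne h)

/-- Every element of the support of a vector of the cut space lies in a signed cocircuit that
conforms to the vector. -/
theorem exists_isSignedCocircuit_conforms {N : OrientedMatroid A} (hN : N.IsRegular) {z : A → ℝ}
    (hz : z ∈ N.cutSpace) {a : A} (ha : z a ≠ 0) :
    ∃ Y, N.IsSignedCocircuit Y ∧ a ∈ Y.support ∧ (∀ b ∈ Y.pos, 0 < z b) ∧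
      ∀ b ∈ Y.neg, z b < 0 := by
  -- Choose `w` of smallest support among the vectors of the cut space that conform to `z` and are
  -- nonzero at `a`; its signs will be the cocircuit.
  obtain ⟨n, ⟨w, ⟨hw, hwz, hwa⟩, hwn⟩, hmin'⟩ := WellFounded.has_min (wellFounded_lt (α := ℕ))
    ((fun w : A → ℝ => (Function.support w).ncard) ''
      {w | w ∈ N.cutSpace ∧ Conforms w z ∧ w a ≠ 0}) ⟨_, z, ⟨hz, Conforms.refl z, ha⟩, rfl⟩
  have hmin : ∀ v ∈ N.cutSpace, Conforms v z → v a ≠ 0 →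
      ¬ (Function.support v ⊂ Function.support w) := fun v hv hvz hva hlt =>
    hmin' _ ⟨v, ⟨hv, hvz, hva⟩, rfl⟩ (hwn ▸ Set.ncard_lt_ncard hlt)
  -- A direction opposing `w` somewhere but not at `a` would cancel a coordinate of `w` while
  -- keeping `w a` nonzero, contradicting minimality.
  have key : ∀ u ∈ N.cutSpace, Function.support u ⊆ Function.support w → 0 ≤ u a * w a →
      (∃ b, u b * w b < 0) → False := by
    rintro u hu hsub hua ⟨b, hb⟩
    obtain ⟨t, ht, hconf, c, hwc, hc⟩ := exists_conforms_add_smul hsub hb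
    refine hmin _ (N.cutSpace.add_mem hw (N.cutSpace.smul_mem t hu)) (hconf.trans hwz) ?_
      ⟨hconf.support_subset, fun h => h hwc hc⟩
    intro h0
    have h1 : w a * w a + t * (u a * w a) = 0 := by
      have : (w a + t * u a) * w a = 0 := mul_eq_zero_of_left h0 _
      linarith
    have := mul_self_pos.2 hwa
    have := mul_nonneg ht.le hua
    linarith
  have hw0 : w ≠ 0 := fun h => hwa (congrFun h a)
  obtain ⟨D, hD, hDw⟩ := exists_isCocircuit_subset_of_mem_cutSpace hw hw0
  -- If `D` were smaller, take `u` in the cut space supported in `D`. One of `u` and `-u` either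
  -- opposes `w` somewhere without opposing it at `a`, or conforms to `w` with smaller support and
  -- is nonzero at `a`.
  have hDeq : D = Function.support w := by
    by_contra hne
    obtain ⟨u, hu, hu0, huD⟩ := exists_mem_cutSpace_support_subset hN hD
    have hsub := huD.trans hDw
    have hneg : Function.support (-u) ⊆ Function.support w := by rwa [Function.support_neg]
    have hpos : ∀ v ∈ N.cutSpace, Function.support v ⊆ D → 0 < v a * w a → False := by
      intro v hv hvD hva
      by_cases hb : ∃ b, v b * w b < 0
      · exact key v hv (hvD.trans hDw) hva.le hb
      push Not at hb
      refine hmin v hv (Conforms.trans (fun b => ⟨fun h => ?_, fun h => ?_⟩) hwz)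
        (left_ne_zero_of_mul hva.ne') ((hvD.trans hDw).ssubset_of_ne fun h => hne
          (hDw.antisymm (h ▸ hvD)))
      · by_contra h'
        exact absurd (hb b) (not_le.2 (mul_neg_of_pos_of_neg h
          ((not_lt.1 h').lt_of_ne (hvD.trans hDw h.ne'))))
      · by_contra h'
        exact absurd (hb b) (not_le.2 (mul_neg_of_neg_of_pos h
          ((not_lt.1 h').lt_of_ne' (hvD.trans hDw h.ne))))
    obtain ⟨b, hb⟩ := Function.ne_iff.1 hu0
    have hbw : u b * w b ≠ 0 := mul_ne_zero hb (hsub hb)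
    rcases lt_trichotomy (u a * w a) 0 with h | h | h
    · exact hpos (-u) (N.cutSpace.neg_mem hu) (by rwa [Function.support_neg]) (by simpa using h)
    · rcases lt_or_gt_of_ne hbw with h' | h'
      · exact key u hu hsub h.ge ⟨b, h'⟩
      · exact key (-u) (N.cutSpace.neg_mem hu) hneg (by simp [h]) ⟨b, by simpa using h'⟩
    · exact hpos u hu huD h
  refine ⟨signs w, ⟨by rwa [support_signs, ← hDeq], fun X hX =>
    orthogonal_signs_of_dotProduct_eq_zero (hw X hX)⟩, by rwa [support_signs],
    fun b hb => (hwz b).1 hb, fun b hb => (hwz b).2 hb⟩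

end OrientedMatroid

/-! ### Disjoint unions and small perturbations on finite sets -/

theorem Set.sUnion_induction_of_pairwiseDisjoint {A : Type*} [Finite A] {P Q : Set A → Prop}
    (h0 : P ∅) (hU : ∀ D U, Q D → P U → Disjoint D U → P (D ∪ U)) {F : Set (Set A)}
    (hQ : ∀ D ∈ F, Q D) (hF : F.PairwiseDisjoint id) : P (⋃₀ F) := by
  induction F, F.toFinite using Set.Finite.induction_on with
  | empty => simpa using h0
  | @insert D G hDG _ ih =>
    rw [Set.sUnion_insert]
    refine hU D _ (hQ D (Set.mem_insert _ _))
      (ih (fun E hE => hQ E (Set.mem_insert_of_mem _ hE)) (hF.subset (Set.subset_insert _ _))) ?_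
    rw [Set.disjoint_sUnion_right]
    exact fun E hE => hF (Set.mem_insert _ _) (Set.mem_insert_of_mem _ hE)
      fun h => hDG (h ▸ hE)

theorem Set.exists_pairwiseDisjoint_sUnion_eq {A : Type*} [Finite A] {P Q : Set A → Prop}
    (h : ∀ U, P U → U.Nonempty → ∃ D ⊆ U, D.Nonempty ∧ Q D ∧ P (U \ D)) (U : Set A) (hU : P U) :
    ∃ F : Set (Set A), (∀ D ∈ F, Q D) ∧ F.PairwiseDisjoint id ∧ ⋃₀ F = U := by
  induction hn : U.ncard using Nat.strong_induction_on generalizing U with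
  | _ n ih =>
    rcases U.eq_empty_or_nonempty with rfl | hne
    · exact ⟨∅, by simp, Set.pairwiseDisjoint_empty, Set.sUnion_empty⟩
    obtain ⟨D, hDU, hD, hQ, hP⟩ := h U hU hne
    have hlt : (U \ D).ncard < n := by
      rw [← hn]
      refine Set.ncard_lt_ncard (Set.sdiff_subset.ssubset_of_ne fun heq => ?_)
      obtain ⟨a, ha⟩ := hD
      exact (heq.symm.subset (hDU ha)).2 ha
    obtain ⟨F, hFQ, hF, hFU⟩ := ih _ hlt _ hP rfl
    refine ⟨insert D F, ?_, ?_, by rw [Set.sUnion_insert, hFU, Set.union_sdiff_cancel hDU]⟩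
    · rintro E (rfl | hE)
      exacts [hQ, hFQ E hE]
    · refine hF.insert fun E hE _ => ?_
      have : E ⊆ U \ D := hFU ▸ Set.subset_sUnion_of_mem hE
      exact (Set.disjoint_sdiff_right (s := D) (t := U)).mono_right this

theorem exists_pos_forall_of_forall_exists_pos {A : Type*} [Finite A] {P : A → ℝ → Prop}
    (h : ∀ a, ∃ δ > 0, ∀ ε, 0 < ε → ε ≤ δ → P a ε) : ∃ ε > 0, ∀ a, P a ε := by
  have h1 : ∀ᶠ ε in nhdsWithin (0 : ℝ) (Set.Ioi 0), ∀ a, P a ε := by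
    rw [Filter.eventually_all]
    intro a
    obtain ⟨δ, hδ, hP⟩ := h a
    filter_upwards [Ioc_mem_nhdsGT hδ] with ε hε using hP ε hε.1 hε.2
  obtain ⟨ε, h2, h3⟩ := (h1.and self_mem_nhdsWithin).exists
  exact ⟨ε, h3, h2⟩

/-! ### Cocycles as cube vertices with integral circuit values -/

namespace OrientedMatroid

open SignedSet Matrix

variable {A : Type*}

/-- The point whose coordinates are `1/2` on `S` and `0` elsewhere. -/
noncomputable def halfPoint (S : Set A) : A → ℝ := S.indicator fun _ => 1 / 2

theorem halfPoint_of_mem {S : Set A} {a : A} (h : a ∈ S) : halfPoint S a = 1 / 2 :=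
  Set.indicator_of_mem h _

theorem halfPoint_of_notMem {S : Set A} {a : A} (h : a ∉ S) : halfPoint S a = 0 :=
  Set.indicator_of_notMem h _

theorem halfPoint_nonneg (S : Set A) (a : A) : 0 ≤ halfPoint S a :=
  Set.indicator_nonneg (fun _ _ => by norm_num) a

theorem halfPoint_le (S : Set A) (a : A) : halfPoint S a ≤ 1 / 2 :=
  Set.indicator_le' (fun _ _ => le_rfl) (fun _ _ => by norm_num) a

variable [Fintype A]

theorem exists_int_dotProduct (X : SignedSet A) {y : A → ℝ} (hy : ∀ a, ∃ n : ℤ, y a = n) :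
    ∃ n : ℤ, X.vec ⬝ᵥ y = n := by
  have hX : ∀ a, ∃ n : ℤ, X.vec a = n := by
    intro a
    by_cases ha : a ∈ X.support
    · rcases X.vec_eq_one_or ha with h | h
      exacts [⟨1, by simp [h]⟩, ⟨-1, by simp [h]⟩]
    · exact ⟨0, by simp [vec_of_notMem ha]⟩
  choose f hf using hX
  choose g hg using hy
  exact ⟨∑ a, f a * g a, by simp [dotProduct, hf, hg]⟩

/-- A set containing no cocircuit is coindependent, so some base avoids it; the circuit is the
fundamental circuit of `a` in that base. This isolates one coordinate in parity and integrality
arguments. -/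
theorem exists_circuit_inter_subset_singleton {N : OrientedMatroid A} {F : Set A}
    (hF : ∀ D, N.underlying.IsCocircuit D → ¬ D ⊆ F) {a : A} (ha : a ∈ F) :
    ∃ X ∈ N.circuits, X.vec a = 1 ∧ ∀ b ∈ F, b ≠ a → X.vec b = 0 := by
  have hco : N.underlying.Coindep F :=
    Matroid.coindep_iff_forall_subset_not_isCocircuit.2
      ⟨fun K hK hKc => hF K hKc hK, Set.subset_univ _⟩
  obtain ⟨B, hB, hBF⟩ := hco.exists_isBase_subset_compl
  obtain ⟨X, hX, hs, h1⟩ := N.exists_fundamental_signedCircuit hB (d := a) fun h => (hBF h).2 ha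
  exact ⟨X, hX, h1, fun b hb hba =>
    vec_of_notMem fun h => (hs h).elim hba fun h' => (hBF h').2 hb⟩

/-- With `Y` a signed cocircuit on `D`, `halfPoint D` is half of `Y.vec`, which is orthogonal to
circuits, plus the integral indicator of `Y.neg`. -/
theorem dotProduct_halfPoint_isInt_of_isCocircuit {N : OrientedMatroid A} (hN : N.IsRegular)
    {D : Set A} (hD : N.underlying.IsCocircuit D) {X : SignedSet A} (hX : X ∈ N.circuits) :
    ∃ n : ℤ, X.vec ⬝ᵥ halfPoint D = n := by
  obtain ⟨y, hy, hy0, hyD⟩ := exists_mem_cutSpace_support_subset hN hD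
  obtain ⟨a, ha⟩ := Function.ne_iff.1 hy0
  obtain ⟨Y, hY, -, hp, hn⟩ := exists_isSignedCocircuit_conforms hN hy ha
  have hYD : Y.support = D := by
    refine hY.1.isCircuit.eq_of_subset_isCircuit hD.isCircuit fun b hb => hyD ?_
    rcases hb with hb | hb
    exacts [(hp b hb).ne', (hn b hb).ne]
  have hdec : halfPoint D = (1 / 2 : ℝ) • Y.vec + Y.neg.indicator 1 := by
    funext b
    simp only [Pi.add_apply, Pi.smul_apply, smul_eq_mul]
    by_cases hb : b ∈ Y.support
    · rw [halfPoint_of_mem (hYD ▸ hb)]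
      by_cases hbn : b ∈ Y.neg
      · simp only [vec_of_mem_neg hbn, hbn, Set.indicator_of_mem, Pi.one_apply]
        norm_num
      · simp [vec_of_mem_pos (hb.resolve_right hbn), hbn]
    · rw [halfPoint_of_notMem (hYD ▸ hb), vec_of_notMem hb,
        Set.indicator_of_notMem fun h => hb (Or.inr h)]
      simp
  rw [hdec, dotProduct_add, dotProduct_smul, hY.vec_mem hN X hX, smul_zero, zero_add]
  refine exists_int_dotProduct X fun b => ?_
  by_cases hb : b ∈ Y.neg
  exacts [⟨1, by simp [hb]⟩, ⟨0, by simp [hb]⟩]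

/-- A set is a cocycle if and only if it meets every circuit in an even number of elements. -/
theorem isCocycle_iff {N : OrientedMatroid A} (hN : N.IsRegular) {S : Set A} :
    N.IsCocycle S ↔ ∀ X ∈ N.circuits, ∃ n : ℤ, X.vec ⬝ᵥ halfPoint S = n := by
  constructor
  · rintro ⟨F, hF, hdisj, rfl⟩
    refine Set.sUnion_induction_of_pairwiseDisjoint
      (P := fun S => ∀ X ∈ N.circuits, ∃ n : ℤ, X.vec ⬝ᵥ halfPoint S = n) ?_ ?_ hF hdisj
    · exact fun X _ => ⟨0, by simp [halfPoint]⟩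
    · intro D U hD hU hDU X hX
      obtain ⟨m, hm⟩ := dotProduct_halfPoint_isInt_of_isCocircuit hN hD hX
      obtain ⟨n, hn⟩ := hU X hX
      refine ⟨m + n, ?_⟩
      rw [halfPoint, Set.indicator_union_of_disjoint hDU]
      change X.vec ⬝ᵥ (halfPoint D + halfPoint U) = _
      rw [dotProduct_add, hm, hn, Int.cast_add]
  · refine Set.exists_pairwiseDisjoint_sUnion_eq
      (P := fun S => ∀ X ∈ N.circuits, ∃ n : ℤ, X.vec ⬝ᵥ halfPoint S = n)
      (Q := N.underlying.IsCocircuit) (fun U hU hne => ?_) S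
    obtain ⟨a, ha⟩ := hne
    -- Otherwise some circuit meets `U` only in `a`, and its value at `halfPoint U` is 1/2, not an
    -- integer.
    have hex : ∃ D, N.underlying.IsCocircuit D ∧ D ⊆ U := by
      by_contra hcon
      push Not at hcon
      obtain ⟨X, hX, h1, h0⟩ := exists_circuit_inter_subset_singleton hcon ha
      obtain ⟨n, hn⟩ := hU X hX
      rw [dotProduct, Finset.sum_eq_single_of_mem a (Finset.mem_univ a), h1,
        halfPoint_of_mem ha] at hn
      · have : (1 : ℤ) = 2 * n := by
          have : (1 : ℝ) = 2 * n := by linarith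
          exact_mod_cast this
        omega
      · intro b _ hba
        by_cases hb : b ∈ U
        · rw [h0 b hb hba, zero_mul]
        · rw [halfPoint_of_notMem hb, mul_zero]
    obtain ⟨D, hD, hDU⟩ := hex
    refine ⟨D, hDU, hD.nonempty, hD, fun X hX => ?_⟩
    obtain ⟨m, hm⟩ := dotProduct_halfPoint_isInt_of_isCocircuit hN hD hX
    obtain ⟨n, hn⟩ := hU X hX
    refine ⟨n - m, ?_⟩
    rw [halfPoint, Set.indicator_sdiff hDU]
    change X.vec ⬝ᵥ (halfPoint U - halfPoint D) = _
    rw [dotProduct_sub, hm, hn, Int.cast_sub]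

end OrientedMatroid

/-! ### Reorientations, cocycle classes and acyclicity -/

namespace OrientedMatroid

open SignedSet Matrix

variable {A : Type*}

theorem _root_.SignedSet.reorient_reorient (X : SignedSet A) (S : Set A) :
    (X.reorient S).reorient S = X := by
  ext a <;> simp only [SignedSet.reorient, Set.mem_union, Set.mem_sdiff, Set.mem_inter_iff] <;>
    tauto

theorem _root_.SignedSet.orthogonal_reorient {X Y : SignedSet A} (S : Set A) :
    (X.reorient S).Orthogonal (Y.reorient S) ↔ X.Orthogonal Y := by
  have h1 : ((X.reorient S).pos ∩ (Y.reorient S).pos) ∪ ((X.reorient S).neg ∩ (Y.reorient S).neg) =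
      (X.pos ∩ Y.pos) ∪ (X.neg ∩ Y.neg) := by
    ext a
    simp only [SignedSet.reorient, Set.mem_union, Set.mem_sdiff, Set.mem_inter_iff]
    tauto
  have h2 : ((X.reorient S).pos ∩ (Y.reorient S).neg) ∪ ((X.reorient S).neg ∩ (Y.reorient S).pos) =
      (X.pos ∩ Y.neg) ∪ (X.neg ∩ Y.pos) := by
    ext a
    simp only [SignedSet.reorient, Set.mem_union, Set.mem_sdiff, Set.mem_inter_iff]
    tauto
  rw [Orthogonal, Orthogonal, h1, h2]

/-- The vector whose coordinates are `-1` on `S` and `1` elsewhere. -/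
noncomputable def reorientSign (S : Set A) (a : A) : ℝ := 1 - 4 * halfPoint S a

theorem reorientSign_of_mem {S : Set A} {a : A} (h : a ∈ S) : reorientSign S a = -1 := by
  rw [reorientSign, halfPoint_of_mem h]; norm_num

theorem reorientSign_of_notMem {S : Set A} {a : A} (h : a ∉ S) : reorientSign S a = 1 := by
  rw [reorientSign, halfPoint_of_notMem h]; norm_num

theorem reorientSign_ne_zero (S : Set A) (a : A) : reorientSign S a ≠ 0 := by
  by_cases h : a ∈ S
  · rw [reorientSign_of_mem h]; norm_num
  · rw [reorientSign_of_notMem h]; norm_num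

theorem vec_eq_indicator_reorientSign {Y : SignedSet A} {S : Set A} (hp : Disjoint Y.pos S)
    (hn : Y.neg ⊆ S) : Y.vec = Y.support.indicator (reorientSign S) := by
  funext a
  by_cases ha : a ∈ Y.support
  · rw [Set.indicator_of_mem ha]
    rcases ha with h | h
    · rw [vec_of_mem_pos h, reorientSign_of_notMem (Set.disjoint_left.1 hp h)]
    · rw [vec_of_mem_neg h, reorientSign_of_mem (hn h)]
  · rw [Set.indicator_of_notMem ha, vec_of_notMem ha]

theorem indicator_symmDiff_reorientSign (S T : Set A) :
    (symmDiff S T).indicator (reorientSign S) = (2 : ℝ) • (halfPoint T - halfPoint S) := by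
  classical
  funext a
  simp only [Set.indicator_apply, Set.mem_symmDiff, reorientSign, halfPoint, Pi.smul_apply,
    Pi.sub_apply, smul_eq_mul]
  by_cases h : a ∈ S <;> by_cases h' : a ∈ T <;> (simp [h, h']; try norm_num)

theorem underlying_reorient [Finite A] (N : OrientedMatroid A) (S : Set A) :
    (N.reorient S).underlying = N.underlying := by
  refine Matroid.ext_isCircuit rfl fun C _ => ?_
  rw [underlying_isCircuit_iff, underlying_isCircuit_iff]
  constructor
  · rintro ⟨_, ⟨X, hX, rfl⟩, h⟩
    exact ⟨X, hX, by rw [← h, support_reorient]⟩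
  · rintro ⟨X, hX, h⟩
    exact ⟨_, ⟨X, hX, rfl⟩, by rw [support_reorient, h]⟩

theorem isSignedCocircuit_reorient_iff [Finite A] {N : OrientedMatroid A} {S : Set A}
    {Y : SignedSet A} :
    (N.reorient S).IsSignedCocircuit (Y.reorient S) ↔ N.IsSignedCocircuit Y := by
  rw [IsSignedCocircuit, IsSignedCocircuit, underlying_reorient, support_reorient]
  refine and_congr_right fun _ => ⟨fun h X hX => ?_, ?_⟩
  · exact (orthogonal_reorient S).1 (h _ ⟨X, hX, rfl⟩)
  · rintro h _ ⟨X, hX, rfl⟩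
    exact (orthogonal_reorient S).2 (h X hX)

theorem isPositiveCocircuit_reorient_iff [Finite A] {N : OrientedMatroid A} {S D : Set A} :
    (N.reorient S).IsPositiveCocircuit D ↔
      ∃ Y, N.IsSignedCocircuit Y ∧ Disjoint Y.pos S ∧ Y.neg ⊆ S ∧ Y.support = D := by
  have hneg : ∀ Y : SignedSet A, (Y.reorient S).neg = ∅ ↔ Disjoint Y.pos S ∧ Y.neg ⊆ S := by
    intro Y
    rw [SignedSet.reorient, Set.union_empty_iff, Set.sdiff_eq_empty, Set.disjoint_iff_inter_eq_empty,
      and_comm]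
  constructor
  · rintro ⟨Y, hY, hn, hs⟩
    rw [← Y.reorient_reorient S] at hY hn
    obtain ⟨h1, h2⟩ := (hneg _).1 hn
    exact ⟨_, isSignedCocircuit_reorient_iff.1 hY, h1, h2, by rw [support_reorient, hs]⟩
  · rintro ⟨Y, hY, h1, h2, hs⟩
    exact ⟨_, isSignedCocircuit_reorient_iff.2 hY, (hneg Y).2 ⟨h1, h2⟩, by
      rw [support_reorient, hs]⟩

variable [Fintype A]

/-- A vector of the cut space whose signs are those prescribed by `S` decomposes along positive
cocircuits of the reorientation. -/
theorem exists_isPositiveCocircuit_of_mem_cutSpace {N : OrientedMatroid A} (hN : N.IsRegular)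
    {S : Set A} {z : A → ℝ} (hz : z ∈ N.cutSpace) (hzS : ∀ a, 0 ≤ reorientSign S a * z a) {a : A}
    (ha : z a ≠ 0) :
    ∃ D, (N.reorient S).IsPositiveCocircuit D ∧ a ∈ D ∧ D ⊆ Function.support z := by
  obtain ⟨Y, hY, haY, hp, hn⟩ := exists_isSignedCocircuit_conforms hN hz ha
  refine ⟨Y.support, isPositiveCocircuit_reorient_iff.2 ⟨Y, hY, ?_, fun b hb => ?_, rfl⟩, haY, ?_⟩
  · refine Set.disjoint_left.2 fun b hb hbS => ?_
    have h1 := hzS b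
    have h2 := hp b hb
    rw [reorientSign_of_mem hbS] at h1
    linarith
  · by_contra hbS
    have h1 := hzS b
    have h2 := hn b hb
    rw [reorientSign_of_notMem hbS] at h1
    linarith
  · rintro b (hb | hb)
    exacts [(hp b hb).ne', (hn b hb).ne]

theorem IsPositiveCocircuit.indicator_mem {N : OrientedMatroid A} (hN : N.IsRegular) {S D : Set A}
    (hD : (N.reorient S).IsPositiveCocircuit D) :
    D.indicator (reorientSign S) ∈ N.cutSpace := by
  obtain ⟨Y, hY, hp, hn, rfl⟩ := isPositiveCocircuit_reorient_iff.1 hD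
  rw [← vec_eq_indicator_reorientSign hp hn]
  exact hY.vec_mem hN

/-- Signed indicators of disjoint positive cocircuits add up inside the cut space. Conversely, such
an indicator contains a positive cocircuit by conformality, and removing it leaves an indicator of
the same kind, so the set can be peeled greedily. -/
theorem isPositiveCocycle_reorient_iff {N : OrientedMatroid A} (hN : N.IsRegular) {S U : Set A} :
    (N.reorient S).IsPositiveCocycle U ↔ U.indicator (reorientSign S) ∈ N.cutSpace := by
  constructor
  · rintro ⟨F, hF, hdisj, rfl⟩
    refine Set.sUnion_induction_of_pairwiseDisjoint
      (P := fun U => U.indicator (reorientSign S) ∈ N.cutSpace) ?_ ?_ hF hdisj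
    · rw [Set.indicator_empty]
      exact N.cutSpace.zero_mem
    · intro D U hD hU hDU
      rw [Set.indicator_union_of_disjoint hDU]
      exact N.cutSpace.add_mem (hD.indicator_mem hN) hU
  · refine Set.exists_pairwiseDisjoint_sUnion_eq
      (P := fun U => U.indicator (reorientSign S) ∈ N.cutSpace)
      (Q := (N.reorient S).IsPositiveCocircuit) (fun U hU ⟨a, ha⟩ => ?_) U
    obtain ⟨D, hD, haD, hDU⟩ := exists_isPositiveCocircuit_of_mem_cutSpace hN hU (S := S)
      (fun b => by
        by_cases hb : b ∈ U
        · rw [Set.indicator_of_mem hb]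
          exact mul_self_nonneg _
        · rw [Set.indicator_of_notMem hb, mul_zero]) (a := a)
      (by rw [Set.indicator_of_mem ha]; exact reorientSign_ne_zero S a)
    have hDU' : D ⊆ U := hDU.trans Set.support_indicator_subset
    refine ⟨D, hDU', ⟨a, haD⟩, hD, ?_⟩
    rw [Set.indicator_sdiff hDU']
    exact N.cutSpace.sub_mem hU (hD.indicator_mem hN)

theorem mem_cocycleClass_iff {N : OrientedMatroid A} (hN : N.IsRegular) {S T : Set A} :
    T ∈ N.cocycleClass S ↔ halfPoint T - halfPoint S ∈ N.cutSpace := by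
  change (N.reorient S).IsPositiveCocycle (symmDiff S T) ↔ _
  rw [isPositiveCocycle_reorient_iff hN, indicator_symmDiff_reorientSign,
    Submodule.smul_mem_iff _ two_ne_zero]

/-- A class consists of the cube vertices in one translate of the cut space, so being in the same
class is an equivalence relation. -/
theorem cocycleClass_eq_iff {N : OrientedMatroid A} (hN : N.IsRegular) {S T : Set A} :
    N.cocycleClass S = N.cocycleClass T ↔ halfPoint S - halfPoint T ∈ N.cutSpace := by
  constructor
  · intro h
    rw [← mem_cocycleClass_iff hN, ← h, mem_cocycleClass_iff hN, sub_self]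
    exact N.cutSpace.zero_mem
  · intro h
    ext U
    rw [mem_cocycleClass_iff hN, mem_cocycleClass_iff hN,
      ← N.cutSpace.add_mem_iff_left h, sub_add_sub_cancel]

/-- A reorientation is acyclic if and only if the corresponding vertex of the cube can be moved
into the interior of the cube in a direction of the cut space. -/
theorem isAcyclic_reorient_iff {N : OrientedMatroid A} (hN : N.IsRegular) {S : Set A} :
    (N.reorient S).IsAcyclic ↔
      ∃ y : A → ℝ, (∀ a, 0 < y a ∧ y a < 1 / 2) ∧ y - halfPoint S ∈ N.cutSpace := by
  classical
  constructor
  · intro h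
    choose D hD haD using h
    -- Each summand points weakly into the cube at `halfPoint S`, and the summand of index `a` does
    -- so strictly at `a`.
    let z : A → ℝ := ∑ a, (D a).indicator (reorientSign S)
    have hz : z ∈ N.cutSpace := Submodule.sum_mem _ fun a _ => (hD a).indicator_mem hN
    have hpos : ∀ a, 0 < reorientSign S a * z a := by
      intro a
      simp only [z, Finset.sum_apply, Finset.mul_sum]
      refine Finset.sum_pos' (fun b _ => ?_) ⟨a, Finset.mem_univ a, ?_⟩
      · by_cases hab : a ∈ D b
        · rw [Set.indicator_of_mem hab]
          exact mul_self_nonneg _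
        · rw [Set.indicator_of_notMem hab, mul_zero]
      · rw [Set.indicator_of_mem (haD a)]
        exact mul_self_pos.2 (reorientSign_ne_zero S a)
    obtain ⟨ε, hε, hy⟩ := exists_pos_forall_of_forall_exists_pos
      (P := fun a ε => 0 < halfPoint S a + ε * z a ∧ halfPoint S a + ε * z a < 1 / 2) (fun a => by
        have hza : 0 < |z a| := abs_pos.2 (right_ne_zero_of_mul (hpos a).ne')
        -- With this bound a coordinate moves by at most 1/4, so it cannot reach the opposite face.
        refine ⟨1 / 4 / |z a|, by positivity, fun ε hε hle => ?_⟩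
        rw [le_div_iff₀ hza] at hle
        have h0 : 0 < ε * |z a| := mul_pos hε hza
        have h1 := hpos a
        by_cases ha : a ∈ S
        · rw [reorientSign_of_mem ha] at h1
          rw [abs_of_neg (by linarith)] at hle h0
          rw [halfPoint_of_mem ha]
          constructor <;> linarith
        · rw [reorientSign_of_notMem ha] at h1
          rw [abs_of_pos (by linarith)] at hle h0
          rw [halfPoint_of_notMem ha]
          constructor <;> linarith)
    refine ⟨halfPoint S + ε • z, hy, ?_⟩
    rw [add_sub_cancel_left]
    exact N.cutSpace.smul_mem ε hz
  · rintro ⟨y, hy, hz⟩ a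
    have hpos : ∀ b, 0 < reorientSign S b * (y - halfPoint S) b := by
      intro b
      have := hy b
      by_cases hb : b ∈ S
      · rw [reorientSign_of_mem hb, Pi.sub_apply, halfPoint_of_mem hb]
        linarith
      · rw [reorientSign_of_notMem hb, Pi.sub_apply, halfPoint_of_notMem hb]
        linarith
    obtain ⟨D, hD, haD, -⟩ := exists_isPositiveCocircuit_of_mem_cutSpace hN hz
      (fun b => (hpos b).le) (right_ne_zero_of_mul (hpos a).ne')
    exact ⟨D, hD, haD⟩

/-- Acyclicity only asks that the translate of the cut space meet the open cube, and all members of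
a class share that translate. -/
theorem isAcyclicClass_cocycleClass_iff {N : OrientedMatroid A} (hN : N.IsRegular) {S : Set A} :
    N.IsAcyclicClass (N.cocycleClass S) ↔ (N.reorient S).IsAcyclic := by
  constructor
  · intro h
    refine h S ((mem_cocycleClass_iff hN).2 ?_)
    rw [sub_self]
    exact N.cutSpace.zero_mem
  · intro h T hT
    obtain ⟨y, hy, hyS⟩ := (isAcyclic_reorient_iff hN).1 h
    refine (isAcyclic_reorient_iff hN).2 ⟨y, hy, ?_⟩
    rw [← sub_sub_sub_cancel_right y _ (halfPoint S)]
    exact N.cutSpace.sub_mem hyS ((mem_cocycleClass_iff hN).1 hT)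

end OrientedMatroid

/-! ### Vertices of the polytopes and their classes -/

namespace OrientedMatroid

open SignedSet Matrix

variable {A : Type*} [Fintype A] {N : OrientedMatroid A}

theorem sub_mem_cutSpace_of_isValueMap {x y : A → ℝ} {α : N.circuits → ℤ}
    (hx : N.IsValueMap x α) (hy : N.IsValueMap y α) : x - y ∈ N.cutSpace := fun X hX => by
  rw [dotProduct_sub, hx ⟨X, hX⟩, hy ⟨X, hX⟩, sub_self]

theorem IsValueMap.of_sub_mem_cutSpace {x y : A → ℝ} {α : N.circuits → ℤ}
    (hx : N.IsValueMap x α) (h : y - x ∈ N.cutSpace) : N.IsValueMap y α := fun X => by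
  rw [← hx X, ← sub_eq_zero, ← dotProduct_sub]
  exact h X.1 X.2

theorem IsValueMap.unique {x : A → ℝ} {α β : N.circuits → ℤ}
    (hα : N.IsValueMap x α) (hβ : N.IsValueMap x β) : α = β := by
  funext X
  have := (hα X).symm.trans (hβ X)
  exact_mod_cast this

theorem IsValueMap.mem_polytope {x : A → ℝ} {α : N.circuits → ℤ} (hα : N.IsValueMap x α)
    (hx : ∀ a, 0 ≤ x a ∧ x a ≤ 1 / 2) : x ∈ N.polytope α :=
  ⟨⟨hx, fun C hC => ⟨α ⟨C, hC⟩, hα ⟨C, hC⟩⟩⟩, hα⟩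

theorem isCompact_polytope (N : OrientedMatroid A) (α : N.circuits → ℤ) :
    IsCompact (N.polytope α) := by
  have heq : N.polytope α = Set.univ.pi (fun _ : A => Set.Icc (0 : ℝ) (1 / 2)) ∩
      ⋂ C : N.circuits, {x | C.1.vec ⬝ᵥ x = α C} := by
    ext x
    simp only [Set.mem_inter_iff, Set.mem_univ_pi, Set.mem_Icc, Set.mem_iInter]
    exact ⟨fun h => ⟨h.1.1, h.2⟩, fun h => IsValueMap.mem_polytope h.2 h.1⟩
  rw [heq]
  refine (isCompact_univ_pi fun _ => isCompact_Icc).inter_right (isClosed_iInter fun C => ?_)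
  exact isClosed_eq (continuous_const.dotProduct continuous_id) continuous_const

theorem vertices_nonempty {α : N.circuits → ℤ} (hα : α ∈ N.weakOmega) :
    (N.vertices α).Nonempty :=
  (N.isCompact_polytope α).extremePoints_nonempty (hα.imp fun _ hx => hx)

/-- The fractional coordinates of a vertex contain the support of no nonzero vector of the cut
space. -/
theorem eq_zero_of_mem_vertices {α : N.circuits → ℤ} {x : A → ℝ} (hx : x ∈ N.vertices α)
    {u : A → ℝ} (hu : u ∈ N.cutSpace) (hux : ∀ a, u a ≠ 0 → x a ≠ 0 ∧ x a ≠ 1 / 2) : u = 0 := by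
  have hxP : x ∈ N.polytope α := hx.1
  obtain ⟨ε, hε, hbox⟩ := exists_pos_forall_of_forall_exists_pos
    (P := fun a ε => (0 ≤ x a + ε * u a ∧ x a + ε * u a ≤ 1 / 2) ∧
      0 ≤ x a + -ε * u a ∧ x a + -ε * u a ≤ 1 / 2) (fun a => by
      have hxa := hxP.1.1 a
      by_cases hua : u a = 0
      · exact ⟨1, one_pos, fun ε _ _ => by simpa [hua] using hxa⟩
      obtain ⟨h0, h1⟩ := hux a hua
      have h0' : 0 < x a := hxa.1.lt_of_ne' h0
      have h1' : 0 < 1 / 2 - x a := sub_pos.2 (hxa.2.lt_of_ne h1)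
      have hpos : 0 < |u a| := abs_pos.2 hua
      refine ⟨min (x a) (1 / 2 - x a) / |u a|, div_pos (lt_min h0' h1') hpos, fun ε hε hle => ?_⟩
      rw [le_div_iff₀ hpos, le_min_iff, ← abs_of_pos hε, ← abs_mul, abs_le, abs_le] at hle
      refine ⟨⟨?_, ?_⟩, ?_, ?_⟩ <;> linarith)
  have hmem : ∀ t : ℝ, (∀ a, 0 ≤ x a + t * u a ∧ x a + t * u a ≤ 1 / 2) →
      x + t • u ∈ N.polytope α := fun t ht =>
    (hxP.2.of_sub_mem_cutSpace (by
      rw [add_sub_cancel_left]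
      exact N.cutSpace.smul_mem t hu)).mem_polytope ht
  -- `x` is the midpoint of `x + ε • u` and `x - ε • u`, both in the polytope, so extremality makes
  -- them equal to `x`.
  have heq := hx.2 (hmem ε fun a => (hbox a).1) (hmem (-ε) fun a => (hbox a).2)
    ⟨1 / 2, 1 / 2, by norm_num, by norm_num, by norm_num, by
      rw [← smul_add, neg_smul, add_add_add_comm, add_neg_cancel, add_zero, ← two_smul ℝ x,
        smul_smul]
      norm_num⟩
  exact (smul_eq_zero.1 (add_eq_left.1 heq)).resolve_left hε.ne'

/-- The fractional coordinates contain no cocircuit, so some circuit meets them only in `a`.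
Doubling its integral value at `x` shows that `2 * x a` is an integer, while a fractional `x a` puts
it strictly between 0 and 1. -/
theorem eq_zero_or_eq_half_of_mem_vertices (hN : N.IsRegular) {α : N.circuits → ℤ} {x : A → ℝ}
    (hx : x ∈ N.vertices α) (a : A) : x a = 0 ∨ x a = 1 / 2 := by
  classical
  by_contra ha
  have hF : ∀ D, N.underlying.IsCocircuit D → ¬ D ⊆ {b | ¬ (x b = 0 ∨ x b = 1 / 2)} := by
    intro D hD hDF
    obtain ⟨u, hu, hu0, huD⟩ := exists_mem_cutSpace_support_subset hN hD
    exact hu0 (eq_zero_of_mem_vertices hx hu fun b hb => not_or.1 (hDF (huD hb)))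
  obtain ⟨X, hX, h1, h0⟩ := exists_circuit_inter_subset_singleton hF ha
  obtain ⟨n, hn⟩ := hx.1.1.2 X hX
  obtain ⟨m, hm⟩ := exists_int_dotProduct X
    (y := fun b => if x b = 0 ∨ x b = 1 / 2 then 2 * x b else 0) (fun b => by
      by_cases hb : x b = 0 ∨ x b = 1 / 2
      · rcases hb with hb | hb
        exacts [⟨0, by simp [hb]⟩, ⟨1, by simp [hb]⟩]
      · exact ⟨0, by rw [if_neg hb, Int.cast_zero]⟩)
  have hsum : 2 * (X.vec ⬝ᵥ x) =
      X.vec ⬝ᵥ (fun b => if x b = 0 ∨ x b = 1 / 2 then 2 * x b else 0) + 2 * x a := by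
    have hdec : (2 : ℝ) • x = (fun b => if x b = 0 ∨ x b = 1 / 2 then 2 * x b else 0) +
        fun b => if x b = 0 ∨ x b = 1 / 2 then 0 else 2 * x b := by
      funext b
      simp only [Pi.smul_apply, Pi.add_apply, smul_eq_mul]
      split_ifs <;> simp
    rw [← smul_eq_mul, ← dotProduct_smul, hdec, dotProduct_add]
    congr 1
    rw [dotProduct, Finset.sum_eq_single_of_mem a (Finset.mem_univ a), h1, if_neg ha, one_mul]
    intro b _ hba
    by_cases hb : x b = 0 ∨ x b = 1 / 2
    · rw [if_pos hb, mul_zero]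
    · rw [h0 b hb hba, zero_mul]
  rw [hn, hm] at hsum
  have hxa := hx.1.1.1 a
  push Not at ha
  have hk : 2 * x a = ((2 * n - m : ℤ) : ℝ) := by push_cast; linarith
  have h2 : (0 : ℤ) < 2 * n - m := by
    have := hxa.1.lt_of_ne' ha.1
    have : (0 : ℝ) < ((2 * n - m : ℤ) : ℝ) := by rw [← hk]; linarith
    exact_mod_cast this
  have h3 : 2 * n - m < (1 : ℤ) := by
    have := hxa.2.lt_of_ne ha.2
    have : ((2 * n - m : ℤ) : ℝ) < 1 := by rw [← hk]; linarith
    exact_mod_cast this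
  omega

theorem halfPoint_halfSet (hN : N.IsRegular) {α : N.circuits → ℤ} {x : A → ℝ}
    (hx : x ∈ N.vertices α) : halfPoint (halfSet x) = x := by
  funext a
  by_cases ha : a ∈ halfSet x
  · rw [halfPoint_of_mem ha]
    exact Eq.symm ha
  · rw [halfPoint_of_notMem ha]
    exact ((eq_zero_or_eq_half_of_mem_vertices hN hx a).resolve_right ha).symm

theorem isCocycle_halfSet (hN : N.IsRegular) {α : N.circuits → ℤ} {x : A → ℝ}
    (hx : x ∈ N.vertices α) : N.IsCocycle (halfSet x) := by
  rw [isCocycle_iff hN, halfPoint_halfSet hN hx]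
  exact hx.1.1.2

/-- Both sides say that `x - y` is in the cut space. The case `α = β` gives independence of the
chosen vertex, the other direction injectivity of the map. -/
theorem cocycleClass_halfSet_eq_iff (hN : N.IsRegular) {α β : N.circuits → ℤ} {x y : A → ℝ}
    (hx : x ∈ N.vertices α) (hy : y ∈ N.vertices β) :
    N.cocycleClass (halfSet x) = N.cocycleClass (halfSet y) ↔ α = β := by
  rw [cocycleClass_eq_iff hN, halfPoint_halfSet hN hx, halfPoint_halfSet hN hy]
  constructor
  · exact fun h => hx.1.2.unique (hy.1.2.of_sub_mem_cutSpace h)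
  · rintro rfl
    exact sub_mem_cutSpace_of_isValueMap hx.1.2 hy.1.2

/-- Surjectivity: the value map of `halfPoint S` works, since every vertex of its polytope differs
from `halfPoint S` by a vector of the cut space. -/
theorem exists_mem_weakOmega_of_isCocycle (hN : N.IsRegular) {S : Set A} (hS : N.IsCocycle S) :
    ∃ α ∈ N.weakOmega, ∀ x ∈ N.vertices α, N.cocycleClass (halfSet x) = N.cocycleClass S := by
  choose f hf using (isCocycle_iff hN).1 hS
  have hα : N.IsValueMap (halfPoint S) fun C => f C.1 C.2 := fun C => hf C.1 C.2
  refine ⟨_, ⟨_, hα.mem_polytope fun a => ⟨halfPoint_nonneg S a, halfPoint_le S a⟩⟩,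
    fun x hx => ?_⟩
  rw [cocycleClass_eq_iff hN, halfPoint_halfSet hN hx]
  exact sub_mem_cutSpace_of_isValueMap hx.1.2 hα

theorem mem_strictOmega_iff (hN : N.IsRegular) {α : N.circuits → ℤ} {x : A → ℝ}
    (hx : x ∈ N.vertices α) : α ∈ N.strictOmega ↔ (N.reorient (halfSet x)).IsAcyclic := by
  rw [isAcyclic_reorient_iff hN, halfPoint_halfSet hN hx]
  constructor
  · rintro ⟨y, hy, hyα⟩
    exact ⟨y, hy.1, sub_mem_cutSpace_of_isValueMap hyα hx.1.2⟩
  · rintro ⟨y, hy, hyx⟩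
    have hyα := hx.1.2.of_sub_mem_cutSpace hyx
    exact ⟨y, ⟨hy, fun C hC => ⟨α ⟨C, hC⟩, hyα ⟨C, hC⟩⟩⟩, hyα⟩

theorem strictOmega_subset_weakOmega (N : OrientedMatroid A) : N.strictOmega ⊆ N.weakOmega := by
  rintro α ⟨x, hx, hα⟩
  exact ⟨x, ⟨fun a => ⟨(hx.1 a).1.le, (hx.1 a).2.le⟩, hx.2⟩, hα⟩

end OrientedMatroid

/-! ### The bijection and the enumerations -/

theorem mainTheorem8 {A : Type*} [Fintype A] (N : OrientedMatroid A) (hN : N.IsRegular) :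
    -- every polytope piece has a vertex, and the coordinates of its vertices are `0` or `1/2`
    (∀ α ∈ N.weakOmega, (N.vertices α).Nonempty ∧
      ∀ x ∈ N.vertices α, ∀ a, x a = 0 ∨ x a = 1 / 2) ∧
    -- the map `Ψ` is well defined, is a bijection, and detects acyclicity
    (∃ Ψ : N.weakOmega → N.cocycleClasses,
      (∀ (α : N.weakOmega), ∀ x ∈ N.vertices α.1,
        (Ψ α).1 = N.cocycleClass (OrientedMatroid.halfSet x)) ∧
      Function.Bijective Ψ ∧
      ∀ α : N.weakOmega, α.1 ∈ N.strictOmega ↔ N.IsAcyclicClass (Ψ α).1) ∧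
    -- the resulting enumerations
    N.weakOmega.Finite ∧
    N.weakOmega.ncard = N.cocycleClasses.ncard ∧
    N.strictOmega.Finite ∧
    N.strictOmega.ncard =
      {K : Set (Set A) | ∃ S : Set A, N.IsCocycle S ∧ (N.reorient S).IsAcyclic ∧
        K = N.cocycleClass S}.ncard := by
  -- An arbitrary vertex is chosen in each polytope; the resulting class does not depend on the
  -- choice.
  choose v hv using fun α : N.weakOmega => OrientedMatroid.vertices_nonempty α.2
  let Ψ : N.weakOmega → N.cocycleClasses := fun α =>
    ⟨N.cocycleClass (OrientedMatroid.halfSet (v α)), _,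
      OrientedMatroid.isCocycle_halfSet hN (hv α), rfl⟩
  have hΨ : Function.Bijective Ψ := by
    refine ⟨fun α β h => Subtype.ext
      ((OrientedMatroid.cocycleClass_halfSet_eq_iff hN (hv α) (hv β)).1 (congrArg Subtype.val h)),
      ?_⟩
    rintro ⟨_, S, hS, rfl⟩
    obtain ⟨α, hα, h⟩ := OrientedMatroid.exists_mem_weakOmega_of_isCocycle hN hS
    exact ⟨⟨α, hα⟩, Subtype.ext (h _ (hv ⟨α, hα⟩))⟩
  have hacyc : ∀ α : N.weakOmega, α.1 ∈ N.strictOmega ↔ N.IsAcyclicClass (Ψ α).1 := fun α => by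
    rw [OrientedMatroid.mem_strictOmega_iff hN (hv α)]
    exact (OrientedMatroid.isAcyclicClass_cocycleClass_iff hN).symm
  have hfin : N.weakOmega.Finite := Set.finite_coe_iff.1 (Finite.of_injective Ψ hΨ.1)
  refine ⟨fun α hα => ⟨OrientedMatroid.vertices_nonempty hα, fun x hx =>
    OrientedMatroid.eq_zero_or_eq_half_of_mem_vertices hN hx⟩, ⟨Ψ, fun α x hx =>
      (OrientedMatroid.cocycleClass_halfSet_eq_iff hN (hv α) hx).2 rfl, hΨ, hacyc⟩, hfin,
    Nat.card_congr (Equiv.ofBijective Ψ hΨ), hfin.subset N.strictOmega_subset_weakOmega, ?_⟩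
  -- The second count restricts `Ψ` to the strict value maps; a class is acyclic as soon as one
  -- representative is.
  refine Set.ncard_congr (fun α hα => (Ψ ⟨α, N.strictOmega_subset_weakOmega hα⟩).1) ?_ ?_ ?_
  · intro α hα
    exact ⟨_, OrientedMatroid.isCocycle_halfSet hN (hv _),
      (OrientedMatroid.mem_strictOmega_iff hN (hv ⟨α, _⟩)).1 hα, rfl⟩
  · intro α β hα hβ h
    exact congrArg Subtype.val (hΨ.1 (Subtype.ext h))
  · rintro _ ⟨S, hS, hSa, rfl⟩
    obtain ⟨α, hα⟩ := hΨ.2 ⟨_, S, hS, rfl⟩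
    have h : (Ψ α).1 = N.cocycleClass S := congrArg Subtype.val hα
    exact ⟨α.1, (hacyc α).2 (h ▸ (OrientedMatroid.isAcyclicClass_cocycleClass_iff hN).2 hSa), h⟩
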